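/- Let $N\ge 2$ be an integer and let $\kappa\in\mathbb{R}$ be such that $N\kappa\notin\{-1,-2,-3,\dots\}$ (for instance $\kappa>-\frac1N$). For a real polynomial $f$ in $x=(x_1,\dots,x_N)$ and $1\le i\le N$ let \[ T_if(x)=\frac{\partial f}{\partial x_i}(x)+\kappa\sum_{j\ne i}\frac{f(x)-f(x(i,j))}{x_i-x_j}, \] where $x(i,j)$ is $x$ with the entries number $i$ and $j$ interchanged. Define polynomials $p_n(x_i;x)$ by the formal power series \[ \sum_{n\ge0}p_n(x_i;x)\,r^n=(1-rx_i)^{-1}\prod_{j=1}^N(1-rx_j)^{-\kappa}, \] and let $\Psi^{-1}$ be the linear map from $\mathbb{R}[p_1,p_2]$ to $\mathbb{R}[x_1,\dots,x_N]$ with $\Psi^{-1}(p_1^ap_2^b)=p_a(x_1;x)\,p_b(x_2;x)$. Let $\phi_{nj}$ and $\psi_{nj}$ be the images under $\Psi^{-1}$ of the coefficients of $t^ns^j$ in the formal power series \[ u_1=\frac{1-st(p_1+p_2)+t^2p_1p_2}{(1-2stp_1+t^2p_1^2)(1-2stp_2+t^2p_2^2)},\qquad u_2=\frac{t(p_1-p_2)}{(1-2stp_1+t^2p_1^2)(1-2stp_2+t^2p_2^2)},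 \] respectively. Let $g_0^o=g_0^e=1$ and, for $n\ge0$, \[ g_{n+1}^o(v)=(v+3n+1)g_n^o(v)-n(2n-1)g_{n-1}^o(v),\qquad g_{n+1}^e(v)=(v+3n+2)g_n^e(v)-n(2n+1)g_{n-1}^e(v) \] (for $n=0$ the last terms are absent), and write $(a)_j=a(a+1)\cdots(a+j-1)$. For $m=0,1,2,\dots$ put \begin{align*} h_{2m+1}^-&=\sum_{j=0}^m2^{-j}\frac{g_j^o(N\kappa-\kappa+m)}{(N\kappa+m+2)_j}\psi_{2m+1,2j},& h_{2m}^-&=\sum_{j=0}^{m-1}2^{-j}\frac{g_j^e(N\kappa-\kappa+m)}{(N\kappa+m+2)_j}\psi_{2m,2j+1},\\ h_{2m+1}^+&=\sum_{j=0}^m2^{-j}\frac{g_j^e(N\kappa-\kappa+m+1)}{(N\kappa+m+2)_j}\phi_{2m+1,2j+1},& h_{2m}^+&=\sum_{j=0}^m2^{-j}\frac{g_j^o(N\kappa-\kappa+m)}{(N\kappa+m+1)_j}\phi_{2m,2j}. \end{align*} Let $C\ell_N$ be the real Clifford algebra generated by $\mathbf{e}_1,\dots,\mathbf{e}_N$ with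 $\mathbf{e}_i^2=-1$ and $\mathbf{e}_i\mathbf{e}_j=-\mathbf{e}_j\mathbf{e}_i$ for $i\ne j$. On polynomials in $x$ with coefficients in $C\ell_N$ let $\boldsymbol{D}f=\sum_{i=1}^N\mathbf{e}_iT_if$, and call $f$ monogenic if $\boldsymbol{D}f=0$. Then for every $m=0,1,2,\dots$ the polynomials \[ h_{2m+1}^++\mathbf{e}_1\mathbf{e}_2\,h_{2m+1}^-\qquad\text{and}\qquad h_{2m}^++\mathbf{e}_1\mathbf{e}_2\,\frac{N\kappa-\kappa+m}{2(N\kappa+m+1)}\,h_{2m}^- \] are monogenic. -/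

import Mathlib

open scoped TensorProduct

noncomputable section

namespace PlanarMonogenic

/-! ### Dunkl operators of type `A` -/

/-- The polynomial `f(x(i,j))`, with the coordinates number `i` and `j` interchanged. -/
def swapVars {N : ℕ} (i j : Fin N) : MvPolynomial (Fin N) ℝ →ₐ[ℝ] MvPolynomial (Fin N) ℝ :=
  MvPolynomial.rename (Equiv.swap i j)

theorem sub_dvd_sub_swapVars {N : ℕ} (i j : Fin N) (f : MvPolynomial (Fin N) ℝ) :
    (MvPolynomial.X i - MvPolynomial.X j : MvPolynomial (Fin N) ℝ) ∣ f - swapVars i j f := by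
  induction f using MvPolynomial.induction_on with
  | C a => simp [swapVars]
  | add p q hp hq =>
    have h := dvd_add hp hq
    rw [map_add]
    convert h using 1
    ring
  | mul_X p k hp =>
    have hk : (MvPolynomial.X i - MvPolynomial.X j : MvPolynomial (Fin N) ℝ) ∣
        MvPolynomial.X k - swapVars i j (MvPolynomial.X k) := by
      simp only [swapVars, MvPolynomial.rename_X]
      rcases eq_or_ne k i with rfl | hki
      · simp
      rcases eq_or_ne k j with rfl | hkj
      · rw [Equiv.swap_apply_right]
        exact (dvd_neg.mpr dvd_rfl).trans (by rw [neg_sub])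
      · simp [Equiv.swap_apply_of_ne_of_ne hki hkj]
    have h := dvd_add (hp.mul_right (MvPolynomial.X k)) (hk.mul_left (swapVars i j p))
    rw [map_mul]
    convert h using 1
    ring

/-- The polynomial `(f(x) - f(x(i,j))) / (x_i - x_j)`, for `i ≠ j`. -/
def divDiff {N : ℕ} (i j : Fin N) (f : MvPolynomial (Fin N) ℝ) : MvPolynomial (Fin N) ℝ :=
  (sub_dvd_sub_swapVars i j f).choose

theorem sub_mul_divDiff {N : ℕ} (i j : Fin N) (f : MvPolynomial (Fin N) ℝ) :
    (MvPolynomial.X i - MvPolynomial.X j) * divDiff i j f = f - swapVars i j f :=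
  (sub_dvd_sub_swapVars i j f).choose_spec.symm

theorem X_sub_X_ne_zero {N : ℕ} {i j : Fin N} (h : i ≠ j) :
    (MvPolynomial.X i - MvPolynomial.X j : MvPolynomial (Fin N) ℝ) ≠ 0 :=
  sub_ne_zero.mpr fun e => h (MvPolynomial.X_injective e)

theorem divDiff_add {N : ℕ} {i j : Fin N} (h : i ≠ j) (f g : MvPolynomial (Fin N) ℝ) :
    divDiff i j (f + g) = divDiff i j f + divDiff i j g := by
  apply mul_left_cancel₀ (X_sub_X_ne_zero h)
  rw [mul_add, sub_mul_divDiff, sub_mul_divDiff, sub_mul_divDiff, map_add]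
  ring

theorem divDiff_smul {N : ℕ} {i j : Fin N} (h : i ≠ j) (c : ℝ) (f : MvPolynomial (Fin N) ℝ) :
    divDiff i j (c • f) = c • divDiff i j f := by
  apply mul_left_cancel₀ (X_sub_X_ne_zero h)
  rw [mul_smul_comm, sub_mul_divDiff, sub_mul_divDiff, map_smul, smul_sub]

/-- The Dunkl operator
`T_i f = ∂f/∂x_i + κ ∑_{j ≠ i} (f(x) - f(x(i,j))) / (x_i - x_j)`. -/
def dunkl {N : ℕ} (κ : ℝ) (i : Fin N) :
    MvPolynomial (Fin N) ℝ →ₗ[ℝ] MvPolynomial (Fin N) ℝ where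
  toFun f := MvPolynomial.pderiv i f + κ • ∑ j ∈ Finset.univ.erase i, divDiff i j f
  map_add' f g := by
    rw [Finset.sum_congr rfl fun j hj => divDiff_add (Finset.ne_of_mem_erase hj).symm f g,
      Finset.sum_add_distrib, map_add, smul_add]
    abel
  map_smul' c f := by
    rw [Finset.sum_congr rfl fun j hj => divDiff_smul (Finset.ne_of_mem_erase hj).symm c f,
      ← Finset.smul_sum, Derivation.map_smul, smul_comm κ c, ← smul_add, RingHom.id_apply]

/-! ### The `p`-basis -/

/-- The formal power series `(1 - r a) ^ (-c)` in the variable `r`. -/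
def oneSubRpow {N : ℕ} (a : MvPolynomial (Fin N) ℝ) (c : ℝ) :
    PowerSeries (MvPolynomial (Fin N) ℝ) :=
  PowerSeries.rescale (-a) (PowerSeries.binomialSeries (MvPolynomial (Fin N) ℝ) (-c))

/-- `p_n(x_i; x)`, the coefficient of `r ^ n` in
`(1 - r x_i)⁻¹ ∏_j (1 - r x_j) ^ (-κ)`. -/
def pPoly {N : ℕ} (κ : ℝ) (i : Fin N) (n : ℕ) : MvPolynomial (Fin N) ℝ :=
  PowerSeries.coeff n
    (oneSubRpow (MvPolynomial.X i) 1 * ∏ j : Fin N, oneSubRpow (MvPolynomial.X j) κ)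

/-- The first coordinate index. -/
def ix₁ {N : ℕ} (hN : 2 ≤ N) : Fin N := ⟨0, by omega⟩

/-- The second coordinate index. -/
def ix₂ {N : ℕ} (hN : 2 ≤ N) : Fin N := ⟨1, by omega⟩

/-- The linear map `Ψ⁻¹` on polynomials in the symbols `p₁, p₂`:
`p₁ ^ a * p₂ ^ b ↦ p_a(x_1; x) * p_b(x_2; x)`. -/
def unsymb {N : ℕ} (hN : 2 ≤ N) (κ : ℝ) :
    MvPolynomial (Fin 2) ℝ →ₗ[ℝ] MvPolynomial (Fin N) ℝ :=
  (MvPolynomial.basisMonomials (Fin 2) ℝ).constr ℝ fun α =>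
    pPoly κ (ix₁ hN) (α 0) * pPoly κ (ix₂ hN) (α 1)

/-! ### The basis polynomials `φ_{nj}` and `ψ_{nj}`

The generating functions are power series in `t`, whose coefficients are polynomials in `s` over
the ring of polynomials in `p₁, p₂`. -/

/-- Power series in `t` over `ℝ[p₁, p₂][s]`. -/
abbrev GenSeries : Type := PowerSeries (Polynomial (MvPolynomial (Fin 2) ℝ))

/-- The symbol `p₁` (for `k = 0`) or `p₂` (for `k = 1`). -/
def symP (k : Fin 2) : GenSeries := PowerSeries.C (Polynomial.C (MvPolynomial.X k))

/-- The variable `s`. -/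
def varS : GenSeries := PowerSeries.C Polynomial.X

/-- The variable `t`. -/
def varT : GenSeries := PowerSeries.X

/-- `(1 - 2 s t p + t² p²)⁻¹` for `p = p₁` or `p = p₂`. -/
def invQuad (k : Fin 2) : GenSeries :=
  PowerSeries.invOfUnit (1 - 2 * varS * varT * symP k + varT ^ 2 * symP k ^ 2) 1

/-- `u₁ = (1 - s t (p₁ + p₂) + t² p₁ p₂) / ((1 - 2 s t p₁ + t² p₁²) (1 - 2 s t p₂ + t² p₂²))`. -/
def u₁ : GenSeries :=
  (1 - varS * varT * (symP 0 + symP 1) + varT ^ 2 * symP 0 * symP 1) * invQuad 0 * invQuad 1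

/-- `u₂ = t (p₁ - p₂) / ((1 - 2 s t p₁ + t² p₁²) (1 - 2 s t p₂ + t² p₂²))`. -/
def u₂ : GenSeries := varT * (symP 0 - symP 1) * invQuad 0 * invQuad 1

/-- `φ_{nj}`, the coefficient of `t ^ n * s ^ j` in `u₁`, as a polynomial in `x`. -/
def phi {N : ℕ} (hN : 2 ≤ N) (κ : ℝ) (n j : ℕ) : MvPolynomial (Fin N) ℝ :=
  unsymb hN κ ((PowerSeries.coeff n u₁).coeff j)

/-- `ψ_{nj}`, the coefficient of `t ^ n * s ^ j` in `u₂`, as a polynomial in `x`. -/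
def psi {N : ℕ} (hN : 2 ≤ N) (κ : ℝ) (n j : ℕ) : MvPolynomial (Fin N) ℝ :=
  unsymb hN κ ((PowerSeries.coeff n u₂).coeff j)

/-! ### The planar harmonic polynomials -/

/-- `g_n^o(v)`: `g_0 = 1`, `g_{n+1} = (v + 3n + 1) g_n - n (2n - 1) g_{n-1}`. -/
def gO (v : ℝ) : ℕ → ℝ
  | 0 => 1
  | 1 => v + 1
  | n + 2 => (v + 3 * ((n : ℝ) + 1) + 1) * gO v (n + 1)
      - ((n : ℝ) + 1) * (2 * ((n : ℝ) + 1) - 1) * gO v n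

/-- `g_n^e(v)`: `g_0 = 1`, `g_{n+1} = (v + 3n + 2) g_n - n (2n + 1) g_{n-1}`. -/
def gE (v : ℝ) : ℕ → ℝ
  | 0 => 1
  | 1 => v + 2
  | n + 2 => (v + 3 * ((n : ℝ) + 1) + 2) * gE v (n + 1)
      - ((n : ℝ) + 1) * (2 * ((n : ℝ) + 1) + 1) * gE v n

/-- The Pochhammer symbol `(a)_j = a (a + 1) ⋯ (a + j - 1)`. -/
def poch (a : ℝ) (j : ℕ) : ℝ := (ascPochhammer ℝ j).eval a

/-- `h_{2m+1}^-`. -/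
def hMinusOdd {N : ℕ} (hN : 2 ≤ N) (κ : ℝ) (m : ℕ) : MvPolynomial (Fin N) ℝ :=
  ∑ j ∈ Finset.range (m + 1),
    ((2 : ℝ)⁻¹ ^ j * (gO (N * κ - κ + m) j / poch (N * κ + m + 2) j)) •
      psi hN κ (2 * m + 1) (2 * j)

/-- `h_{2m}^-`. -/
def hMinusEven {N : ℕ} (hN : 2 ≤ N) (κ : ℝ) (m : ℕ) : MvPolynomial (Fin N) ℝ :=
  ∑ j ∈ Finset.range m,
    ((2 : ℝ)⁻¹ ^ j * (gE (N * κ - κ + m) j / poch (N * κ + m + 2) j)) •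
      psi hN κ (2 * m) (2 * j + 1)

/-- `h_{2m+1}^+`. -/
def hPlusOdd {N : ℕ} (hN : 2 ≤ N) (κ : ℝ) (m : ℕ) : MvPolynomial (Fin N) ℝ :=
  ∑ j ∈ Finset.range (m + 1),
    ((2 : ℝ)⁻¹ ^ j * (gE (N * κ - κ + m + 1) j / poch (N * κ + m + 2) j)) •
      phi hN κ (2 * m + 1) (2 * j + 1)

/-- `h_{2m}^+`. -/
def hPlusEven {N : ℕ} (hN : 2 ≤ N) (κ : ℝ) (m : ℕ) : MvPolynomial (Fin N) ℝ :=
  ∑ j ∈ Finset.range (m + 1),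
    ((2 : ℝ)⁻¹ ^ j * (gO (N * κ - κ + m) j / poch (N * κ + m + 1) j)) •
      phi hN κ (2 * m) (2 * j)

/-! ### The Clifford algebra and the Dirac operator -/

/-- The negative definite quadratic form `-(v_1² + ⋯ + v_N²)` on `ℝ^N`. -/
def negSq (N : ℕ) : QuadraticForm ℝ (Fin N → ℝ) :=
  QuadraticMap.weightedSumSquares ℝ fun _ : Fin N => (-1 : ℝ)

/-- The Clifford algebra `Cℓ_N`. -/
abbrev Cl (N : ℕ) : Type := CliffordAlgebra (negSq N)

/-- The generator `e_i` of `Cℓ_N`. -/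
def e {N : ℕ} (i : Fin N) : Cl N := CliffordAlgebra.ι (negSq N) (Pi.single i 1)

/-- Polynomials in `x ∈ ℝ^N` with coefficients in `Cℓ_N`; the variables commute with the
coefficients, and `a ⊗ₜ f` is the polynomial `a f(x)`. -/
abbrev ClPoly (N : ℕ) : Type := Cl N ⊗[ℝ] MvPolynomial (Fin N) ℝ

/-- The Dirac operator `D f = ∑_i e_i T_i f`, where `T_i` acts on the polynomial factor and
`e_i` by multiplication on the left. -/
def dirac {N : ℕ} (κ : ℝ) (f : ClPoly N) : ClPoly N :=
  ∑ i : Fin N, (e i ⊗ₜ[ℝ] (1 : MvPolynomial (Fin N) ℝ)) * (dunkl κ i).lTensor (Cl N) f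

/-- A `Cℓ_N`-valued polynomial is monogenic if `D f = 0`. -/
def IsMonogenic {N : ℕ} (κ : ℝ) (f : ClPoly N) : Prop := dirac κ f = 0

end PlanarMonogenic

end

open scoped TensorProduct

noncomputable section

namespace PlanarMonogenic

/-! ### The binomial series `(1 - r a) ^ (-c)` -/

section Series

variable {N : ℕ}

/-! Everything reduces to a scalar identity for Chebyshev polynomials. Expanding `u₁` and `u₂` shows
that the weight of `p_a(x_1) p_b(x_2)` in `φ_{nj}` and `ψ_{nj}` is the coefficient of `s^j` in
`T_{a-b}` and `U_{a-b-1}`. Hence the `h^+` and `h^-` parts are `planarSum`s with weights `L_a(T_d)`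
and `L_b(U_{d-1})`, where `d = a - b` and `L_a`, `L_b` are linear functionals on `ℝ[s]` given by
moment sequences.

The Dunkl operators act simply on this basis: `T_i p_n(x_i) = (Nκ + n) p_{n-1}(x_i)`, `T_i p_n(x_k)
= 0` for `k ≠ i`, and the product rule adds one cross term, symmetric in `a, b`. Cross terms cancel
under an odd weight; under an even one, summation by parts with `U_d - U_{d-2} = 2 T_d` turns them
back into products (`crossSum_eq_planarSum`).

For `f + e_1 e_2 g` the Dirac equation is a Cauchy–Riemann system, so comparing weights leaves one
relation for each integer `d` (`isMonogenic_planarSum`). Its explicit factors `d` are absorbed by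
derivative formulas for `T_d` and `U_{d-1}`, which makes it a consequence of recurrences on the
moments (`moment_chebyshev_relation`). The stated coefficients satisfy these by the contiguity
relations `gO_succ_eq_gE` and `mul_gE_eq_gO`. -/

/-- The coefficient `(c)_n / n!` of `(1 - r) ^ (-c)`. -/
def risingCoeff (c : ℝ) (n : ℕ) : ℝ := (-1) ^ n * Ring.choose (-c) n

theorem risingCoeff_zero (c : ℝ) : risingCoeff c 0 = 1 := by
  simp [risingCoeff]

theorem risingCoeff_succ (c : ℝ) (n : ℕ) :
    ((n : ℝ) + 1) * risingCoeff c (n + 1) = (c + n) * risingCoeff c n := by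
  have h : ((n : ℝ) + 1) * Ring.choose (-c) (n + 1) = Ring.choose (-c) n * (-c - n) := by
    have h := Ring.choose_smul_choose (-c) (Nat.le_succ n)
    simpa [Nat.succ_sub (le_refl n)] using h
  rw [risingCoeff, risingCoeff, pow_succ]
  linear_combination (-1) ^ n * (-1) * h

theorem risingCoeff_one (n : ℕ) : risingCoeff 1 n = 1 := by
  induction n with
  | zero => exact risingCoeff_zero 1
  | succ n ih =>
    have h := risingCoeff_succ 1 n
    have hn : (n : ℝ) + 1 ≠ 0 := by positivity
    rw [ih] at h
    apply mul_left_cancel₀ hn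
    linarith

theorem coeff_oneSubRpow (a : MvPolynomial (Fin N) ℝ) (c : ℝ) (n : ℕ) :
    PowerSeries.coeff n (oneSubRpow a c) = risingCoeff c n • a ^ n := by
  rw [oneSubRpow, PowerSeries.coeff_rescale, PowerSeries.binomialSeries_coeff, risingCoeff,
    neg_pow, mul_smul_comm, mul_one, mul_comm ((-1 : ℝ) ^ n), mul_smul]
  congr 1
  rw [Algebra.smul_def]
  simp

theorem one_sub_mul_oneSubRpow_one (a : MvPolynomial (Fin N) ℝ) :
    (1 - PowerSeries.X * PowerSeries.C a) * oneSubRpow a 1 = 1 := by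
  ext1 n
  rw [sub_mul, one_mul, mul_assoc, map_sub]
  cases n with
  | zero => simp [coeff_oneSubRpow, risingCoeff_one]
  | succ n =>
    rw [PowerSeries.coeff_succ_X_mul, PowerSeries.coeff_C_mul]
    simp [coeff_oneSubRpow, risingCoeff_one, PowerSeries.coeff_one, pow_succ']

theorem oneSubRpow_one_eq (a : MvPolynomial (Fin N) ℝ) :
    oneSubRpow a 1 = 1 + PowerSeries.X * PowerSeries.C a * oneSubRpow a 1 := by
  linear_combination one_sub_mul_oneSubRpow_one a

theorem one_sub_ne_zero (a : MvPolynomial (Fin N) ℝ) :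
    (1 - PowerSeries.X * PowerSeries.C a : PowerSeries (MvPolynomial (Fin N) ℝ)) ≠ 0 :=
  left_ne_zero_of_mul_eq_one (one_sub_mul_oneSubRpow_one a)

/-- The constant series with value the real number `c`. -/
def constSeries (c : ℝ) : PowerSeries (MvPolynomial (Fin N) ℝ) :=
  PowerSeries.C (MvPolynomial.C c)

theorem coeff_constSeries_mul (c : ℝ) (f : PowerSeries (MvPolynomial (Fin N) ℝ)) (n : ℕ) :
    PowerSeries.coeff n (constSeries c * f) = c • PowerSeries.coeff n f := by
  rw [constSeries, PowerSeries.coeff_C_mul, MvPolynomial.smul_eq_C_mul]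

theorem constSeries_one : (constSeries 1 : PowerSeries (MvPolynomial (Fin N) ℝ)) = 1 := by
  simp [constSeries]

/-- Logarithmic derivative `c a / (1 - r a)`, with `oneSubRpow a 1` standing for `1 / (1 - r a)`;
after clearing that denominator it is the recurrence `risingCoeff_succ`. -/
theorem derivative_oneSubRpow (a : MvPolynomial (Fin N) ℝ) (c : ℝ) :
    PowerSeries.derivative (MvPolynomial (Fin N) ℝ) (oneSubRpow a c) =
      constSeries c * (PowerSeries.C a * oneSubRpow a 1) * oneSubRpow a c := by
  apply mul_left_cancel₀ (one_sub_ne_zero a)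
  have h : (1 - PowerSeries.X * PowerSeries.C a) *
      PowerSeries.derivative (MvPolynomial (Fin N) ℝ) (oneSubRpow a c) =
        constSeries c * (PowerSeries.C a * oneSubRpow a c) := by
    ext1 n
    rw [sub_mul, one_mul, mul_assoc, map_sub, coeff_constSeries_mul,
      PowerSeries.coeff_C_mul, PowerSeries.coeff_derivative]
    cases n with
    | zero =>
      have h := risingCoeff_succ c 0
      norm_num [risingCoeff_zero] at h
      simp [coeff_oneSubRpow, h, risingCoeff_zero]
    | succ n =>
      rw [PowerSeries.coeff_succ_X_mul, PowerSeries.coeff_C_mul, PowerSeries.coeff_derivative]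
      have h := congrArg (MvPolynomial.C (σ := Fin N)) (risingCoeff_succ c (n + 1))
      simp only [coeff_oneSubRpow, MvPolynomial.smul_eq_C_mul]
      simp only [map_mul, map_add, map_natCast, map_one] at h
      push_cast at h ⊢
      linear_combination a ^ (n + 2) * h
  rw [h]
  linear_combination (-constSeries c * PowerSeries.C a * oneSubRpow a c) *
    one_sub_mul_oneSubRpow_one a

/-- A derivation of the coefficient ring, applied to each coefficient of a power series. -/
def coeffDerivation {A : Type*} [CommRing A] [Algebra ℝ A] (D : Derivation ℝ A A) :
    Derivation ℝ (PowerSeries A) (PowerSeries A) :=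
  Derivation.mk'
    { toFun := fun f => PowerSeries.mk fun n => D (PowerSeries.coeff n f)
      map_add' := fun f g => by ext1 n; simp
      map_smul' := fun c f => by
        ext1 n
        simp only [PowerSeries.coeff_mk, RingHom.id_apply]
        rw [PowerSeries.coeff_smul, PowerSeries.coeff_smul, Derivation.map_smul,
          PowerSeries.coeff_mk] }
    (fun f g => by
      ext1 n
      simp only [LinearMap.coe_mk, AddHom.coe_mk, PowerSeries.coeff_mk, smul_eq_mul, map_add,
        PowerSeries.coeff_mul, map_sum, Derivation.leibniz, Finset.sum_add_distrib]
      congr 1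
      exact Finset.sum_equiv (Equiv.prodComm ℕ ℕ) (by simp [add_comm]) (by simp))

theorem coeff_coeffDerivation {A : Type*} [CommRing A] [Algebra ℝ A] (D : Derivation ℝ A A)
    (f : PowerSeries A) (n : ℕ) :
    PowerSeries.coeff n (coeffDerivation D f) = D (PowerSeries.coeff n f) := by
  simp [coeffDerivation]

/-- The series depends on `r` and `x_i` only through `r x_i`, so `x_i ∂/∂x_i` equals `r d/dr`; the
factor `x_i` is then cancelled. -/
theorem coeffDerivation_oneSubRpow_self (i : Fin N) (c : ℝ) :
    coeffDerivation (MvPolynomial.pderiv i) (oneSubRpow (MvPolynomial.X i) c) =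
      constSeries c * (PowerSeries.X * oneSubRpow (MvPolynomial.X i) 1) *
        oneSubRpow (MvPolynomial.X i) c := by
  have hX : (PowerSeries.C (MvPolynomial.X i) : PowerSeries (MvPolynomial (Fin N) ℝ)) ≠ 0 := by
    rw [Ne, map_eq_zero_iff _ PowerSeries.C_injective]
    exact MvPolynomial.X_ne_zero i
  apply mul_left_cancel₀ hX
  have h : PowerSeries.C (MvPolynomial.X i) *
      coeffDerivation (MvPolynomial.pderiv i) (oneSubRpow (MvPolynomial.X i) c) =
      PowerSeries.X * PowerSeries.derivative (MvPolynomial (Fin N) ℝ)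
        (oneSubRpow (MvPolynomial.X i) c) := by
    ext1 n
    rw [PowerSeries.coeff_C_mul, coeff_coeffDerivation]
    cases n with
    | zero => simp [coeff_oneSubRpow]
    | succ n =>
      rw [PowerSeries.coeff_succ_X_mul, PowerSeries.coeff_derivative, coeff_oneSubRpow,
        Derivation.map_smul, Derivation.leibniz_pow, MvPolynomial.pderiv_X_self]
      simp only [MvPolynomial.smul_eq_C_mul, nsmul_eq_mul, smul_eq_mul, mul_one,
        add_tsub_cancel_right]
      push_cast
      ring
  rw [h, derivative_oneSubRpow]
  ring

theorem coeffDerivation_oneSubRpow_of_ne {i j : Fin N} (h : j ≠ i) (c : ℝ) :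
    coeffDerivation (MvPolynomial.pderiv i) (oneSubRpow (MvPolynomial.X j) c) = 0 := by
  ext1 n
  rw [coeff_coeffDerivation, coeff_oneSubRpow, Derivation.map_smul, Derivation.leibniz_pow,
    MvPolynomial.pderiv_X_of_ne h]
  simp

theorem derivation_prod {A ι : Type*} [CommRing A] [Algebra ℝ A] (D : Derivation ℝ A A)
    (s : Finset ι) (f g : ι → A) (h : ∀ j ∈ s, D (f j) = g j * f j) :
    D (∏ j ∈ s, f j) = (∑ j ∈ s, g j) * ∏ j ∈ s, f j := by
  classical
  induction s using Finset.induction_on with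
  | empty => simp
  | insert a s ha ih =>
    rw [Finset.prod_insert ha, Finset.sum_insert ha, Derivation.leibniz,
      ih fun j hj => h j (Finset.mem_insert_of_mem hj), h a (Finset.mem_insert_self a s)]
    simp only [smul_eq_mul]
    ring

theorem map_swapVars_oneSubRpow (i j : Fin N) (a : MvPolynomial (Fin N) ℝ) (c : ℝ) :
    PowerSeries.map (swapVars i j : MvPolynomial (Fin N) ℝ →+* MvPolynomial (Fin N) ℝ)
      (oneSubRpow a c) = oneSubRpow (swapVars i j a) c := by
  ext1 n
  simp [coeff_oneSubRpow]

/-! ### The Dunkl operators on the `p`-basis -/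

/-- The series `∏_j (1 - r x_j) ^ (-κ)`. -/
def symSeries (N : ℕ) (κ : ℝ) : PowerSeries (MvPolynomial (Fin N) ℝ) :=
  ∏ j : Fin N, oneSubRpow (MvPolynomial.X j) κ

/-- The series `(1 - r x_i)⁻¹ ∏_j (1 - r x_j) ^ (-κ)`. -/
def pSeries (κ : ℝ) (i : Fin N) : PowerSeries (MvPolynomial (Fin N) ℝ) :=
  oneSubRpow (MvPolynomial.X i) 1 * symSeries N κ

theorem coeff_pSeries (κ : ℝ) (i : Fin N) (n : ℕ) :
    PowerSeries.coeff n (pSeries κ i) = pPoly κ i n := rfl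

theorem swapVars_X (i j k : Fin N) :
    swapVars i j (MvPolynomial.X k) = MvPolynomial.X (Equiv.swap i j k) :=
  MvPolynomial.rename_X _ _

theorem map_swapVars_pSeries (κ : ℝ) (i j k : Fin N) :
    PowerSeries.map (swapVars i j : MvPolynomial (Fin N) ℝ →+* MvPolynomial (Fin N) ℝ)
      (pSeries κ k) = pSeries κ (Equiv.swap i j k) := by
  rw [pSeries, pSeries, map_mul, symSeries, map_prod]
  simp only [map_swapVars_oneSubRpow, swapVars_X]
  rw [Equiv.prod_comp (Equiv.swap i j) fun l => oneSubRpow (MvPolynomial.X l) κ]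

theorem swapVars_pPoly (κ : ℝ) (i j k : Fin N) (n : ℕ) :
    swapVars i j (pPoly κ k n) = pPoly κ (Equiv.swap i j k) n := by
  have h := congrArg (PowerSeries.coeff n) (map_swapVars_pSeries κ i j k)
  rwa [PowerSeries.coeff_map, coeff_pSeries, coeff_pSeries] at h

theorem pSeries_eq (κ : ℝ) (i : Fin N) :
    pSeries κ i =
      symSeries N κ + PowerSeries.X * (PowerSeries.C (MvPolynomial.X i) * pSeries κ i) := by
  rw [pSeries]
  linear_combination symSeries N κ * one_sub_mul_oneSubRpow_one (MvPolynomial.X i)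

theorem pPoly_zero (κ : ℝ) (i : Fin N) : pPoly κ i 0 = 1 := by
  rw [← coeff_pSeries, pSeries, symSeries]
  have h (j : Fin N) (c : ℝ) :
      PowerSeries.constantCoeff (oneSubRpow (MvPolynomial.X j) c) = 1 := by
    rw [← PowerSeries.coeff_zero_eq_constantCoeff_apply, coeff_oneSubRpow, risingCoeff_zero]
    simp
  rw [PowerSeries.coeff_zero_eq_constantCoeff_apply, map_mul, map_prod]
  simp [h]

theorem pPoly_succ (κ : ℝ) (i : Fin N) (n : ℕ) :
    pPoly κ i (n + 1) =
      PowerSeries.coeff (n + 1) (symSeries N κ) + MvPolynomial.X i * pPoly κ i n := by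
  rw [← coeff_pSeries, pSeries_eq, map_add, PowerSeries.coeff_succ_X_mul,
    PowerSeries.coeff_C_mul, coeff_pSeries]

/-! ### Divided differences, the twisted Leibniz rule, and the action on `p_n`. -/

theorem divDiff_unique {i j : Fin N} (h : i ≠ j) {f g : MvPolynomial (Fin N) ℝ}
    (hg : (MvPolynomial.X i - MvPolynomial.X j) * g = f - swapVars i j f) : divDiff i j f = g :=
  mul_left_cancel₀ (X_sub_X_ne_zero h) ((sub_mul_divDiff i j f).trans hg.symm)

theorem divDiff_mul {i j : Fin N} (h : i ≠ j) (f g : MvPolynomial (Fin N) ℝ) :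
    divDiff i j (f * g) = divDiff i j f * g + f * divDiff i j g -
      (MvPolynomial.X i - MvPolynomial.X j) * divDiff i j f * divDiff i j g := by
  apply divDiff_unique h
  rw [map_mul]
  linear_combination (g - (MvPolynomial.X i - MvPolynomial.X j) * divDiff i j g) *
    sub_mul_divDiff i j f + swapVars i j f * sub_mul_divDiff i j g

theorem dunkl_apply (κ : ℝ) (i : Fin N) (f : MvPolynomial (Fin N) ℝ) :
    dunkl κ i f = MvPolynomial.pderiv i f + κ • ∑ j ∈ Finset.univ.erase i, divDiff i j f := rfl

theorem dunkl_mul (κ : ℝ) (i : Fin N) (f g : MvPolynomial (Fin N) ℝ) :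
    dunkl κ i (f * g) = dunkl κ i f * g + f * dunkl κ i g -
      κ • ∑ j ∈ Finset.univ.erase i,
        (MvPolynomial.X i - MvPolynomial.X j) * divDiff i j f * divDiff i j g := by
  simp only [dunkl_apply]
  rw [Finset.sum_congr rfl fun j hj => divDiff_mul (Finset.ne_of_mem_erase hj).symm f g,
    Finset.sum_sub_distrib, Finset.sum_add_distrib, ← Finset.sum_mul, ← Finset.mul_sum,
    Derivation.leibniz]
  simp only [MvPolynomial.smul_eq_C_mul, smul_eq_mul]
  ring

theorem divDiff_pPoly_of_ne {i j k : Fin N} (κ : ℝ) (hij : i ≠ j) (hi : k ≠ i) (hj : k ≠ j)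
    (n : ℕ) : divDiff i j (pPoly κ k n) = 0 := by
  apply divDiff_unique hij
  rw [swapVars_pPoly, Equiv.swap_apply_of_ne_of_ne hi hj]
  simp

theorem divDiff_pPoly_right {i j : Fin N} (κ : ℝ) (hij : i ≠ j) (n : ℕ) :
    divDiff i j (pPoly κ j n) = -divDiff i j (pPoly κ i n) := by
  apply divDiff_unique hij
  rw [mul_neg, sub_mul_divDiff, swapVars_pPoly, swapVars_pPoly, Equiv.swap_apply_right,
    Equiv.swap_apply_left]
  ring

theorem sub_mul_divDiff_pPoly (κ : ℝ) (i j : Fin N) (n : ℕ) :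
    (MvPolynomial.X i - MvPolynomial.X j) * divDiff i j (pPoly κ i n) =
      pPoly κ i n - pPoly κ j n := by
  rw [sub_mul_divDiff, swapVars_pPoly, Equiv.swap_apply_left]

theorem divDiff_pPoly_zero {i j : Fin N} (κ : ℝ) (hij : i ≠ j) :
    divDiff i j (pPoly κ i 0) = 0 := by
  apply divDiff_unique hij
  rw [swapVars_pPoly, pPoly_zero, pPoly_zero]
  simp

theorem divDiff_pPoly_succ {i j : Fin N} (κ : ℝ) (hij : i ≠ j) (n : ℕ) :
    divDiff i j (pPoly κ i (n + 1)) =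
      MvPolynomial.X i * divDiff i j (pPoly κ i n) + pPoly κ j n := by
  apply divDiff_unique hij
  rw [swapVars_pPoly, Equiv.swap_apply_left, pPoly_succ, pPoly_succ]
  linear_combination MvPolynomial.X i * sub_mul_divDiff_pPoly κ i j n

/-- The divided differences of the `p`-basis have generating function
`r (1 - r x_i)⁻¹ (1 - r x_j)⁻¹ ∏_k (1 - r x_k) ^ (-κ)`. -/
theorem divDiff_pPoly_eq_coeff {i j : Fin N} (κ : ℝ) (hij : i ≠ j) (n : ℕ) :
    divDiff i j (pPoly κ i n) = PowerSeries.coeff n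
      (PowerSeries.X * (oneSubRpow (MvPolynomial.X j) 1 * pSeries κ i)) := by
  apply divDiff_unique hij
  rw [swapVars_pPoly, Equiv.swap_apply_left, ← coeff_pSeries, ← coeff_pSeries, ← map_sub,
    ← PowerSeries.coeff_C_mul]
  congr 1
  have hi := one_sub_mul_oneSubRpow_one (MvPolynomial.X i : MvPolynomial (Fin N) ℝ)
  have hj := one_sub_mul_oneSubRpow_one (MvPolynomial.X j : MvPolynomial (Fin N) ℝ)
  simp only [pSeries, map_sub]
  linear_combination (oneSubRpow (MvPolynomial.X i) 1 * symSeries N κ) * hj -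
    (oneSubRpow (MvPolynomial.X j) 1 * symSeries N κ) * hi

theorem coeffDerivation_symSeries (κ : ℝ) (i : Fin N) :
    coeffDerivation (MvPolynomial.pderiv i) (symSeries N κ) =
      constSeries κ * (PowerSeries.X * oneSubRpow (MvPolynomial.X i) 1) * symSeries N κ := by
  rw [symSeries, derivation_prod _ _ _ fun j => if j = i then
    constSeries κ * (PowerSeries.X * oneSubRpow (MvPolynomial.X i) 1) else 0]
  · simp
  · intro j _
    split_ifs with h
    · rw [h, coeffDerivation_oneSubRpow_self]
    · rw [coeffDerivation_oneSubRpow_of_ne h, zero_mul]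

theorem derivative_symSeries (κ : ℝ) :
    PowerSeries.derivative (MvPolynomial (Fin N) ℝ) (symSeries N κ) =
      (∑ j : Fin N, constSeries κ *
        (PowerSeries.C (MvPolynomial.X j) * oneSubRpow (MvPolynomial.X j) 1)) * symSeries N κ :=
  derivation_prod ((PowerSeries.derivative (MvPolynomial (Fin N) ℝ)).restrictScalars ℝ)
    Finset.univ _ _ fun _ _ => derivative_oneSubRpow _ κ

/-- The derivative sees only the factor `(1 - r x_i)^(-κ)`, and among the transpositions only `(i
k)` moves `p_n(x_k)`; the two contributions are opposite. -/
theorem dunkl_pPoly_of_ne (κ : ℝ) {i k : Fin N} (h : i ≠ k) (n : ℕ) :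
    dunkl κ i (pPoly κ k n) = 0 := by
  rw [dunkl_apply, Finset.sum_eq_single_of_mem k (Finset.mem_erase.mpr ⟨h.symm, Finset.mem_univ k⟩)
    fun j hj hjk => divDiff_pPoly_of_ne κ (Finset.ne_of_mem_erase hj).symm h.symm hjk.symm n,
    divDiff_pPoly_right κ h, divDiff_pPoly_eq_coeff κ h, ← coeff_pSeries, ← coeff_coeffDerivation,
    smul_neg, ← coeff_constSeries_mul, ← sub_eq_add_neg, sub_eq_zero]
  congr 1
  rw [pSeries, Derivation.leibniz, coeffDerivation_symSeries,
    coeffDerivation_oneSubRpow_of_ne h.symm, pSeries]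
  simp only [smul_eq_mul]
  ring

/-- In the sum over all `j`, the term `j = i` comes from differentiating the symmetric factor and
the others from the divided differences. -/
theorem dunkl_pPoly_self_eq_coeff (κ : ℝ) (i : Fin N) (n : ℕ) :
    dunkl κ i (pPoly κ i n) = PowerSeries.coeff n (PowerSeries.X * (pSeries κ i *
      (oneSubRpow (MvPolynomial.X i) 1 + constSeries κ *
        ∑ j : Fin N, oneSubRpow (MvPolynomial.X j) 1))) := by
  rw [dunkl_apply, Finset.sum_congr rfl fun j hj =>
    divDiff_pPoly_eq_coeff κ (Finset.ne_of_mem_erase hj).symm n, ← map_sum,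
    ← coeff_constSeries_mul, ← coeff_pSeries, ← coeff_coeffDerivation, ← map_add]
  congr 1
  rw [← Finset.add_sum_erase _ _ (Finset.mem_univ i), ← Finset.mul_sum,
    ← Finset.sum_mul, pSeries, Derivation.leibniz, coeffDerivation_symSeries,
    coeffDerivation_oneSubRpow_self, constSeries_one]
  simp only [smul_eq_mul]
  ring

/-- Writing `1 / (1 - r x) = 1 + r x / (1 - r x)` splits the bracket into the constant `Nκ + 1` and
`r` times the logarithmic derivative of `pSeries`. Thus `T_i` acts through `r d/dr + Nκ + 1`, which
is diagonal on coefficients. -/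
theorem X_mul_derivative_pSeries (κ : ℝ) (i : Fin N) :
    PowerSeries.X * PowerSeries.derivative (MvPolynomial (Fin N) ℝ) (pSeries κ i) +
      (constSeries N * constSeries κ + 1) * pSeries κ i = pSeries κ i *
      (oneSubRpow (MvPolynomial.X i) 1 +
        constSeries κ * ∑ j : Fin N, oneSubRpow (MvPolynomial.X j) 1) := by
  have hsum : ∑ j : Fin N, oneSubRpow (MvPolynomial.X j : MvPolynomial (Fin N) ℝ) 1 =
      constSeries N + PowerSeries.X * ∑ j : Fin N, PowerSeries.C (MvPolynomial.X j) *
        oneSubRpow (MvPolynomial.X j : MvPolynomial (Fin N) ℝ) 1 := by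
    rw [Finset.mul_sum]
    conv_lhs => enter [2, j]; rw [oneSubRpow_one_eq]
    simp [Finset.sum_add_distrib, mul_assoc, constSeries]
  rw [hsum, pSeries, Derivation.leibniz, derivative_oneSubRpow, derivative_symSeries,
    constSeries_one, ← Finset.mul_sum]
  simp only [smul_eq_mul]
  linear_combination (-oneSubRpow (MvPolynomial.X i) 1 * symSeries N κ) *
    oneSubRpow_one_eq (MvPolynomial.X i : MvPolynomial (Fin N) ℝ)

theorem dunkl_pPoly_zero (κ : ℝ) (i : Fin N) : dunkl κ i (pPoly κ i 0) = 0 := by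
  rw [dunkl_pPoly_self_eq_coeff, PowerSeries.coeff_zero_X_mul]

theorem dunkl_pPoly_succ (κ : ℝ) (i : Fin N) (n : ℕ) :
    dunkl κ i (pPoly κ i (n + 1)) = ((N : ℝ) * κ + (n + 1)) • pPoly κ i n := by
  rw [dunkl_pPoly_self_eq_coeff, PowerSeries.coeff_succ_X_mul, ← X_mul_derivative_pSeries, map_add,
    show (constSeries N * constSeries κ + 1 : PowerSeries (MvPolynomial (Fin N) ℝ)) =
      constSeries ((N : ℝ) * κ + 1) by simp [constSeries], coeff_constSeries_mul, coeff_pSeries]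
  have h : PowerSeries.coeff n (PowerSeries.X *
      PowerSeries.derivative (MvPolynomial (Fin N) ℝ) (pSeries κ i)) = (n : ℝ) • pPoly κ i n := by
    cases n with
    | zero => simp
    | succ n =>
      rw [PowerSeries.coeff_succ_X_mul, PowerSeries.coeff_derivative, coeff_pSeries,
        MvPolynomial.smul_eq_C_mul]
      simp
      ring
  rw [h, ← add_smul]
  congr 1
  ring

end Series

/-! ### Chebyshev expansions of `φ_{nj}` and `ψ_{nj}` -/

section Chebyshev

open Polynomial.Chebyshev Finset.HasAntidiagonal

/-- By the three-term recurrence the left side is unchanged under `(a, b) ↦ (a - 1, b - 1)`, and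
`U_{-1} = 0` settles `b = 0`. The index `a` is an integer because the descent may take it below
zero. -/
theorem chebyshev_U_mul_sub (R : Type*) [CommRing R] (a : ℤ) (b : ℕ) :
    U R (a - 1) * U R b - U R a * U R (b - 1) = U R (a - b - 1) := by
  induction b generalizing a with
  | zero => simp
  | succ b ih =>
    have h := ih (a - 1)
    have h1 := U_eq R a
    have h2 := U_add_one R b
    push_cast
    rw [show a - (b + 1) - 1 = a - 1 - b - 1 by ring, ← h, add_sub_cancel_right, h2, h1,
      show a - 1 - 1 = a - 2 by ring]
    ring

theorem chebyshev_U_mul_add (R : Type*) [CommRing R] (a : ℤ) (b : ℕ) :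
    U R a * U R b - Polynomial.X * U R (a - 1) * U R b - Polynomial.X * U R a * U R (b - 1) +
      U R (a - 1) * U R (b - 1) = T R (a - b) := by
  induction b generalizing a with
  | zero =>
    have h := T_eq_U_sub_X_mul_U R a
    simp [h]
  | succ b ih =>
    have h := ih (a - 1)
    have h1 := U_eq R a
    have h2 := U_add_one R b
    push_cast
    rw [show a - (b + 1) = a - 1 - b by ring, ← h, add_sub_cancel_right, h2, h1,
      show a - 1 - 1 = a - 2 by ring]
    ring

/-- The series `∑_n U_n(s) p^n t^n` for `p = p₁` or `p = p₂`. -/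
def chebSeries (k : Fin 2) : GenSeries :=
  PowerSeries.mk fun n => U (MvPolynomial (Fin 2) ℝ) n * Polynomial.C (MvPolynomial.X k ^ n)

theorem coeff_chebSeries (k : Fin 2) (n : ℕ) :
    PowerSeries.coeff n (chebSeries k) = U (MvPolynomial (Fin 2) ℝ) n * Polynomial.C (MvPolynomial.X k ^ n) :=
  PowerSeries.coeff_mk _ _

/-- The formula includes `n = 0` because `U_{-1} = 0`, so products of these series need no boundary
terms. -/
theorem coeff_T_symP_chebSeries (k : Fin 2) (n : ℕ) :
    PowerSeries.coeff n (varT * (symP k * chebSeries k)) =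
      U (MvPolynomial (Fin 2) ℝ) (n - 1) * Polynomial.C (MvPolynomial.X k ^ n) := by
  cases n with
  | zero => simp [varT]
  | succ n =>
    rw [varT, PowerSeries.coeff_succ_X_mul, symP, PowerSeries.coeff_C_mul, coeff_chebSeries]
    push_cast
    rw [add_sub_cancel_right, pow_succ, map_mul]
    ring

theorem quad_mul_chebSeries (k : Fin 2) :
    (1 - 2 * varS * varT * symP k + varT ^ 2 * symP k ^ 2) * chebSeries k = 1 := by
  have h : (1 - 2 * varS * varT * symP k + varT ^ 2 * symP k ^ 2) * chebSeries k =
      chebSeries k - PowerSeries.C (2 * Polynomial.X) * (varT * (symP k * chebSeries k)) +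
        varT * (symP k * (varT * (symP k * chebSeries k))) := by
    rw [map_mul, ← varS, map_ofNat]
    ring
  rw [h]
  ext1 n
  rw [map_add, map_sub, PowerSeries.coeff_C_mul, coeff_T_symP_chebSeries, coeff_chebSeries]
  cases n with
  | zero => simp [varT]
  | succ n =>
    conv_lhs =>
      rw [varT, PowerSeries.coeff_succ_X_mul, ← varT, symP, PowerSeries.coeff_C_mul, ← symP,
        coeff_T_symP_chebSeries]
    have hU := U_add_one (MvPolynomial (Fin 2) ℝ) n
    push_cast
    rw [PowerSeries.coeff_one, if_neg n.succ_ne_zero, hU, add_sub_cancel_right, pow_succ, map_mul]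
    ring

theorem invQuad_eq (k : Fin 2) : invQuad k = chebSeries k := by
  have h : (1 - 2 * varS * varT * symP k + varT ^ 2 * symP k ^ 2) * invQuad k = 1 :=
    PowerSeries.mul_invOfUnit _ _ (by simp [varT])
  calc invQuad k = ((1 - 2 * varS * varT * symP k + varT ^ 2 * symP k ^ 2) * chebSeries k) *
        invQuad k := by rw [quad_mul_chebSeries, one_mul]
    _ = ((1 - 2 * varS * varT * symP k + varT ^ 2 * symP k ^ 2) * invQuad k) * chebSeries k := by
        ring
    _ = chebSeries k := by rw [h, one_mul]

theorem coeff_u₁ (n : ℕ) :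
    PowerSeries.coeff n u₁ = ∑ p ∈ antidiagonal n,
      T (MvPolynomial (Fin 2) ℝ) ((p.1 : ℤ) - p.2) *
        Polynomial.C (MvPolynomial.X 0 ^ p.1 * MvPolynomial.X 1 ^ p.2) := by
  have h : u₁ = chebSeries 0 * chebSeries 1 -
      PowerSeries.C Polynomial.X * ((varT * (symP 0 * chebSeries 0)) * chebSeries 1) -
      PowerSeries.C Polynomial.X * (chebSeries 0 * (varT * (symP 1 * chebSeries 1))) +
      (varT * (symP 0 * chebSeries 0)) * (varT * (symP 1 * chebSeries 1)) := by
    rw [u₁, invQuad_eq, invQuad_eq, ← varS]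
    ring
  rw [h, map_add, map_sub, map_sub, PowerSeries.coeff_C_mul, PowerSeries.coeff_C_mul]
  rw [PowerSeries.coeff_mul, PowerSeries.coeff_mul, PowerSeries.coeff_mul, PowerSeries.coeff_mul]
  simp only [coeff_T_symP_chebSeries, coeff_chebSeries, Finset.mul_sum]
  rw [← Finset.sum_sub_distrib, ← Finset.sum_sub_distrib, ← Finset.sum_add_distrib]
  refine Finset.sum_congr rfl fun p _ => ?_
  rw [← chebyshev_U_mul_add, map_mul]
  ring

theorem coeff_u₂ (n : ℕ) :
    PowerSeries.coeff n u₂ = ∑ p ∈ antidiagonal n,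
      U (MvPolynomial (Fin 2) ℝ) ((p.1 : ℤ) - p.2 - 1) *
        Polynomial.C (MvPolynomial.X 0 ^ p.1 * MvPolynomial.X 1 ^ p.2) := by
  have h : u₂ = (varT * (symP 0 * chebSeries 0)) * chebSeries 1 -
      chebSeries 0 * (varT * (symP 1 * chebSeries 1)) := by
    rw [u₂, invQuad_eq, invQuad_eq]
    ring
  rw [h, map_sub, PowerSeries.coeff_mul, PowerSeries.coeff_mul]
  simp only [coeff_T_symP_chebSeries, coeff_chebSeries]
  rw [← Finset.sum_sub_distrib]
  refine Finset.sum_congr rfl fun p _ => ?_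
  rw [← chebyshev_U_mul_sub, map_mul]
  ring

variable {N : ℕ}

/-- The product `p_a(x_1; x) p_b(x_2; x)`. -/
def pProd (hN : 2 ≤ N) (κ : ℝ) (a b : ℕ) : MvPolynomial (Fin N) ℝ :=
  pPoly κ (ix₁ hN) a * pPoly κ (ix₂ hN) b

theorem unsymb_X_pow_mul (hN : 2 ≤ N) (κ : ℝ) (a b : ℕ) :
    unsymb hN κ (MvPolynomial.X 0 ^ a * MvPolynomial.X 1 ^ b) = pProd hN κ a b := by
  have h : (MvPolynomial.X 0 ^ a * MvPolynomial.X 1 ^ b : MvPolynomial (Fin 2) ℝ) =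
      MvPolynomial.basisMonomials (Fin 2) ℝ (Finsupp.single 0 a + Finsupp.single 1 b) := by
    rw [MvPolynomial.coe_basisMonomials, MvPolynomial.X_pow_eq_monomial,
      MvPolynomial.X_pow_eq_monomial, MvPolynomial.monomial_mul, one_mul]
  rw [h, unsymb, Module.Basis.constr_basis, pProd]
  simp

theorem unsymb_coeff_sum (hN : 2 ≤ N) (κ : ℝ) (n j : ℕ) (f : ℕ × ℕ → Polynomial ℝ) :
    unsymb hN κ ((∑ p ∈ antidiagonal n, (f p).map (MvPolynomial.C (σ := Fin 2)) *
      Polynomial.C (MvPolynomial.X 0 ^ p.1 * MvPolynomial.X 1 ^ p.2)).coeff j) =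
    ∑ p ∈ antidiagonal n, (f p).coeff j • pProd hN κ p.1 p.2 := by
  rw [Polynomial.finsetSum_coeff, map_sum]
  refine Finset.sum_congr rfl fun p _ => ?_
  rw [Polynomial.coeff_mul_C, Polynomial.coeff_map, ← MvPolynomial.smul_eq_C_mul, map_smul,
    unsymb_X_pow_mul]

theorem phi_eq_sum (hN : 2 ≤ N) (κ : ℝ) (n j : ℕ) :
    phi hN κ n j = ∑ p ∈ antidiagonal n,
      (T ℝ ((p.1 : ℤ) - p.2)).coeff j • pProd hN κ p.1 p.2 := by
  rw [phi, coeff_u₁, ← unsymb_coeff_sum]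
  simp only [map_T]

theorem psi_eq_sum (hN : 2 ≤ N) (κ : ℝ) (n j : ℕ) :
    psi hN κ n j = ∑ p ∈ antidiagonal n,
      (U ℝ ((p.1 : ℤ) - p.2 - 1)).coeff j • pProd hN κ p.1 p.2 := by
  rw [psi, coeff_u₂, ← unsymb_coeff_sum]
  simp only [map_U]

end Chebyshev

/-! ### The Dunkl operators on `p_a(x_1; x) p_b(x_2; x)` -/

section DunklProd

open Finset.HasAntidiagonal

variable {N : ℕ}

theorem ix₁_ne_ix₂ (hN : 2 ≤ N) : ix₁ hN ≠ ix₂ hN := by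
  simp [ix₁, ix₂]

/-- The polynomial `(x_1 - x_2) d_a d_b`, where `d_n` is the divided difference of
`p_n(x_1; x)` in `x_1` and `x_2`. -/
def crossTerm (hN : 2 ≤ N) (κ : ℝ) (a b : ℕ) : MvPolynomial (Fin N) ℝ :=
  (MvPolynomial.X (ix₁ hN) - MvPolynomial.X (ix₂ hN)) *
    divDiff (ix₁ hN) (ix₂ hN) (pPoly κ (ix₁ hN) a) *
      divDiff (ix₁ hN) (ix₂ hN) (pPoly κ (ix₁ hN) b)

theorem crossTerm_comm (hN : 2 ≤ N) (κ : ℝ) (a b : ℕ) :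
    crossTerm hN κ a b = crossTerm hN κ b a := by
  rw [crossTerm, crossTerm]
  ring

theorem crossTerm_zero_left (hN : 2 ≤ N) (κ : ℝ) (b : ℕ) : crossTerm hN κ 0 b = 0 := by
  rw [crossTerm, divDiff_pPoly_zero κ (ix₁_ne_ix₂ hN)]
  ring

theorem crossTerm_zero_right (hN : 2 ≤ N) (κ : ℝ) (a : ℕ) : crossTerm hN κ a 0 = 0 := by
  rw [crossTerm_comm, crossTerm_zero_left]

/-- In `d_{n+1} = x_1 d_n + p_n(x_2)` the part `x_1 d_n` contributes `x_1 (x_1 - x_2) d_a d_b` to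
both cross terms and cancels. -/
theorem crossTerm_succ_sub (hN : 2 ≤ N) (κ : ℝ) (a b : ℕ) :
    crossTerm hN κ a (b + 1) - crossTerm hN κ (a + 1) b = pProd hN κ a b - pProd hN κ b a := by
  have ha := sub_mul_divDiff_pPoly κ (ix₁ hN) (ix₂ hN) a
  have hb := sub_mul_divDiff_pPoly κ (ix₁ hN) (ix₂ hN) b
  rw [crossTerm, crossTerm, pProd, pProd, divDiff_pPoly_succ κ (ix₁_ne_ix₂ hN),
    divDiff_pPoly_succ κ (ix₁_ne_ix₂ hN)]
  linear_combination pPoly κ (ix₂ hN) b * ha - pPoly κ (ix₂ hN) a * hb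

theorem divDiff_swap {i j : Fin N} (h : i ≠ j) (f : MvPolynomial (Fin N) ℝ) :
    divDiff j i f = -divDiff i j f := by
  apply divDiff_unique h.symm
  rw [show swapVars j i f = swapVars i j f by rw [swapVars, swapVars, Equiv.swap_comm]]
  linear_combination sub_mul_divDiff i j f

theorem dunkl_ix₁_pProd (hN : 2 ≤ N) (κ : ℝ) (a b : ℕ) :
    dunkl κ (ix₁ hN) (pProd hN κ a b) =
      dunkl κ (ix₁ hN) (pPoly κ (ix₁ hN) a) * pPoly κ (ix₂ hN) b + κ • crossTerm hN κ a b := by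
  have h := ix₁_ne_ix₂ hN
  rw [pProd, dunkl_mul, dunkl_pPoly_of_ne κ h, Finset.sum_eq_single_of_mem (ix₂ hN)
    (Finset.mem_erase.mpr ⟨h.symm, Finset.mem_univ _⟩), divDiff_pPoly_right κ h, crossTerm]
  · simp only [MvPolynomial.smul_eq_C_mul]
    ring
  · intro j hj hj2
    rw [divDiff_pPoly_of_ne κ (Finset.ne_of_mem_erase hj).symm h.symm hj2.symm b, mul_zero]

theorem dunkl_ix₂_pProd (hN : 2 ≤ N) (κ : ℝ) (a b : ℕ) :
    dunkl κ (ix₂ hN) (pProd hN κ a b) =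
      pPoly κ (ix₁ hN) a * dunkl κ (ix₂ hN) (pPoly κ (ix₂ hN) b) - κ • crossTerm hN κ a b := by
  have h := ix₁_ne_ix₂ hN
  rw [pProd, dunkl_mul, dunkl_pPoly_of_ne κ h.symm, Finset.sum_eq_single_of_mem (ix₁ hN)
    (Finset.mem_erase.mpr ⟨h, Finset.mem_univ _⟩), divDiff_swap h, divDiff_swap h,
    divDiff_pPoly_right κ h, crossTerm]
  · simp only [MvPolynomial.smul_eq_C_mul]
    ring
  · intro j hj hj2
    rw [divDiff_pPoly_of_ne κ (Finset.ne_of_mem_erase hj).symm h hj2.symm a, mul_zero, zero_mul]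

theorem dunkl_pProd_of_ne (hN : 2 ≤ N) (κ : ℝ) {i : Fin N} (h₁ : i ≠ ix₁ hN) (h₂ : i ≠ ix₂ hN)
    (a b : ℕ) : dunkl κ i (pProd hN κ a b) = 0 := by
  rw [pProd, dunkl_mul, dunkl_pPoly_of_ne κ h₁, dunkl_pPoly_of_ne κ h₂, Finset.sum_eq_zero]
  · simp
  · intro j hj
    have hij := (Finset.ne_of_mem_erase hj).symm
    rcases eq_or_ne j (ix₁ hN) with hj1 | hj1
    · rw [divDiff_pPoly_of_ne κ hij h₂.symm (by rw [hj1]; exact (ix₁_ne_ix₂ hN).symm) b, mul_zero]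
    · rw [divDiff_pPoly_of_ne κ hij h₁.symm hj1.symm a, mul_zero, zero_mul]

/-- The combination `∑_{a+b=n} w(a-b) p_a(x_1; x) p_b(x_2; x)`. -/
def planarSum (hN : 2 ≤ N) (κ : ℝ) (w : ℤ → ℝ) (n : ℕ) : MvPolynomial (Fin N) ℝ :=
  ∑ p ∈ antidiagonal n, w ((p.1 : ℤ) - p.2) • pProd hN κ p.1 p.2

/-- The combination `∑_{a+b=n} w(a-b) (x_1 - x_2) d_a d_b`. -/
def crossSum (hN : 2 ≤ N) (κ : ℝ) (w : ℤ → ℝ) (n : ℕ) : MvPolynomial (Fin N) ℝ :=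
  ∑ p ∈ antidiagonal n, w ((p.1 : ℤ) - p.2) • crossTerm hN κ p.1 p.2

theorem dunkl_planarSum_of_ne (hN : 2 ≤ N) (κ : ℝ) (w : ℤ → ℝ) (n : ℕ) {i : Fin N}
    (h₁ : i ≠ ix₁ hN) (h₂ : i ≠ ix₂ hN) : dunkl κ i (planarSum hN κ w n) = 0 := by
  rw [planarSum, map_sum]
  refine Finset.sum_eq_zero fun p _ => ?_
  rw [map_smul, dunkl_pProd_of_ne hN κ h₁ h₂, smul_zero]

theorem dunkl_planarSum_zero (hN : 2 ≤ N) (κ : ℝ) (w : ℤ → ℝ) (i : Fin N) :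
    dunkl κ i (planarSum hN κ w 0) = 0 := by
  have h : dunkl κ i (1 : MvPolynomial (Fin N) ℝ) = 0 := by
    rw [← pPoly_zero κ i, dunkl_pPoly_zero]
  simp [planarSum, pProd, pPoly_zero, h]

theorem dunkl_ix₁_planarSum (hN : 2 ≤ N) (κ : ℝ) (w : ℤ → ℝ) (n : ℕ) :
    dunkl κ (ix₁ hN) (planarSum hN κ w (n + 1)) =
      ∑ p ∈ antidiagonal n, (((N : ℝ) * κ + (p.1 + 1)) * w ((p.1 : ℤ) - p.2 + 1)) •
        pProd hN κ p.1 p.2 + κ • crossSum hN κ w (n + 1) := by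
  rw [planarSum, map_sum]
  simp only [map_smul, dunkl_ix₁_pProd, smul_add, Finset.sum_add_distrib]
  congr 1
  · rw [Finset.Nat.sum_antidiagonal_succ, dunkl_pPoly_zero, zero_mul, smul_zero, zero_add]
    refine Finset.sum_congr rfl fun p _ => ?_
    rw [dunkl_pPoly_succ, smul_mul_assoc, smul_smul, mul_comm, pProd]
    push_cast
    rw [add_sub_right_comm]
  · rw [crossSum, Finset.smul_sum]
    exact Finset.sum_congr rfl fun p _ => smul_comm _ _ _

theorem dunkl_ix₂_planarSum (hN : 2 ≤ N) (κ : ℝ) (w : ℤ → ℝ) (n : ℕ) :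
    dunkl κ (ix₂ hN) (planarSum hN κ w (n + 1)) =
      ∑ p ∈ antidiagonal n, (((N : ℝ) * κ + (p.2 + 1)) * w ((p.1 : ℤ) - p.2 - 1)) •
        pProd hN κ p.1 p.2 - κ • crossSum hN κ w (n + 1) := by
  rw [planarSum, map_sum]
  simp only [map_smul, dunkl_ix₂_pProd, smul_sub, Finset.sum_sub_distrib]
  congr 1
  · rw [Finset.Nat.sum_antidiagonal_succ', dunkl_pPoly_zero, mul_zero, smul_zero, zero_add]
    refine Finset.sum_congr rfl fun p _ => ?_
    rw [dunkl_pPoly_succ, mul_smul_comm, smul_smul, mul_comm, pProd]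
    push_cast
    rw [sub_add_eq_sub_sub]
  · rw [crossSum, Finset.smul_sum]
    exact Finset.sum_congr rfl fun p _ => smul_comm _ _ _

theorem crossSum_odd (hN : 2 ≤ N) (κ : ℝ) {w : ℤ → ℝ} (hw : ∀ d, w (-d) = -w d) (n : ℕ) :
    crossSum hN κ w n = 0 := by
  have h : crossSum hN κ w n = -crossSum hN κ w n := by
    conv_lhs => rw [crossSum, ← Finset.Nat.sum_antidiagonal_swap]
    rw [crossSum, ← Finset.sum_neg_distrib]
    refine Finset.sum_congr rfl fun p _ => ?_
    rw [Prod.fst_swap, Prod.snd_swap, crossTerm_comm, ← neg_sub (p.1 : ℤ), hw, neg_smul]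
  exact self_eq_neg.mp h

/-- Summation by parts: oddness of `u` antisymmetrizes the products, `crossTerm_succ_sub` makes them
differences of cross terms, and reindexing moves the difference onto `u`. Boundary terms vanish
since `d_0 = 0`. -/
theorem crossSum_eq_planarSum (hN : 2 ≤ N) (κ : ℝ) {w u : ℤ → ℝ} (hu : ∀ d, u (-d) = -u d)
    (hwu : ∀ d, u (d + 1) - u (d - 1) = 2 * w d) (n : ℕ) :
    crossSum hN κ w (n + 1) = planarSum hN κ u n := by
  have hswap : planarSum hN κ u n =
      -∑ p ∈ antidiagonal n, u ((p.1 : ℤ) - p.2) • pProd hN κ p.2 p.1 := by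
    rw [planarSum, ← Finset.Nat.sum_antidiagonal_swap, ← Finset.sum_neg_distrib]
    refine Finset.sum_congr rfl fun p _ => ?_
    rw [Prod.fst_swap, Prod.snd_swap, ← neg_sub (p.1 : ℤ), hu, neg_smul]
  have hleft : ∑ p ∈ antidiagonal n, u ((p.1 : ℤ) - p.2) • crossTerm hN κ p.1 (p.2 + 1) =
      ∑ p ∈ antidiagonal (n + 1), u ((p.1 : ℤ) - p.2 + 1) • crossTerm hN κ p.1 p.2 := by
    rw [Finset.Nat.sum_antidiagonal_succ', crossTerm_zero_right, smul_zero, zero_add]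
    refine Finset.sum_congr rfl fun p _ => ?_
    push_cast
    rw [sub_add_eq_sub_sub, sub_add_cancel]
  have hright : ∑ p ∈ antidiagonal n, u ((p.1 : ℤ) - p.2) • crossTerm hN κ (p.1 + 1) p.2 =
      ∑ p ∈ antidiagonal (n + 1), u ((p.1 : ℤ) - p.2 - 1) • crossTerm hN κ p.1 p.2 := by
    rw [Finset.Nat.sum_antidiagonal_succ, crossTerm_zero_left, smul_zero, zero_add]
    refine Finset.sum_congr rfl fun p _ => ?_
    push_cast
    rw [add_sub_right_comm, add_sub_cancel_right]
  have htwo : (2 : ℝ) • crossSum hN κ w (n + 1) = (2 : ℝ) • planarSum hN κ u n := by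
    rw [two_smul ℝ (planarSum hN κ u n)]
    nth_rw 2 [hswap]
    rw [← sub_eq_add_neg, planarSum, ← Finset.sum_sub_distrib, crossSum, Finset.smul_sum]
    simp only [← smul_sub, ← crossTerm_succ_sub]
    simp only [smul_sub, Finset.sum_sub_distrib]
    rw [hleft, hright, ← Finset.sum_sub_distrib]
    refine Finset.sum_congr rfl fun p _ => ?_
    rw [← sub_smul, hwu, mul_smul]
  exact smul_right_injective _ (two_ne_zero' ℝ) htwo

end DunklProd

/-! ### A criterion for monogenic polynomials -/

section Criterion

open Finset.HasAntidiagonal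

variable {N : ℕ}

/-! ### Clifford relations and the Cauchy–Riemann system. -/

theorem e_mul_self (i : Fin N) : e i * e i = -1 := by
  have h : negSq N (Pi.single i 1) = -1 := by
    simp [negSq, QuadraticMap.weightedSumSquares_apply, Pi.single_apply]
  rw [e, CliffordAlgebra.ι_sq_scalar, h, map_neg, map_one]

theorem e_mul_e_of_ne {i j : Fin N} (h : i ≠ j) : e i * e j = -(e j * e i) := by
  rw [eq_neg_iff_add_eq_zero, e, e, CliffordAlgebra.ι_mul_ι_add_swap]
  have hp : QuadraticMap.polar (negSq N) (Pi.single i 1) (Pi.single j 1) = 0 := by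
    simp only [QuadraticMap.polar, negSq, QuadraticMap.weightedSumSquares_apply, Pi.add_apply,
      ← Finset.sum_sub_distrib]
    refine Finset.sum_eq_zero fun k _ => ?_
    rcases eq_or_ne k i with rfl | hk
    · simp [h]
    · simp [hk]
  rw [hp, map_zero]

/-- The Dirac equation for `f + e_1 e_2 g`, as Cauchy–Riemann type equations. -/
theorem isMonogenic_of_dunkl (hN : 2 ≤ N) (κ : ℝ) {f g : MvPolynomial (Fin N) ℝ}
    (h₁ : dunkl κ (ix₁ hN) f + dunkl κ (ix₂ hN) g = 0)
    (h₂ : dunkl κ (ix₂ hN) f - dunkl κ (ix₁ hN) g = 0)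
    (hf : ∀ i, i ≠ ix₁ hN → i ≠ ix₂ hN → dunkl κ i f = 0)
    (hg : ∀ i, i ≠ ix₁ hN → i ≠ ix₂ hN → dunkl κ i g = 0) :
    IsMonogenic κ ((1 : Cl N) ⊗ₜ[ℝ] f + (e (ix₁ hN) * e (ix₂ hN)) ⊗ₜ[ℝ] g) := by
  have hne := ix₁_ne_ix₂ hN
  have hterm (i : Fin N) : (e i ⊗ₜ[ℝ] (1 : MvPolynomial (Fin N) ℝ)) * (dunkl κ i).lTensor (Cl N)
      ((1 : Cl N) ⊗ₜ[ℝ] f + (e (ix₁ hN) * e (ix₂ hN)) ⊗ₜ[ℝ] g) =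
      e i ⊗ₜ[ℝ] dunkl κ i f + (e i * (e (ix₁ hN) * e (ix₂ hN))) ⊗ₜ[ℝ] dunkl κ i g := by
    rw [map_add, LinearMap.lTensor_tmul, LinearMap.lTensor_tmul, mul_add,
      Algebra.TensorProduct.tmul_mul_tmul, Algebra.TensorProduct.tmul_mul_tmul, mul_one, one_mul,
      one_mul]
  have e₁ : e (ix₁ hN) * (e (ix₁ hN) * e (ix₂ hN)) = -e (ix₂ hN) := by
    rw [← mul_assoc, e_mul_self, neg_one_mul]
  have e₂ : e (ix₂ hN) * (e (ix₁ hN) * e (ix₂ hN)) = e (ix₁ hN) := by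
    rw [← mul_assoc, e_mul_e_of_ne hne.symm, neg_mul, mul_assoc, e_mul_self, mul_neg, mul_one,
      neg_neg]
  rw [IsMonogenic, dirac, Finset.sum_congr rfl fun i _ => hterm i, ← Finset.sum_subset
    (Finset.subset_univ {ix₁ hN, ix₂ hN}), Finset.sum_pair hne, e₁, e₂]
  · rw [eq_neg_of_add_eq_zero_left h₁, sub_eq_zero.mp h₂, TensorProduct.tmul_neg,
      TensorProduct.neg_tmul]
    abel
  · intro i _ hi
    simp only [Finset.mem_insert, Finset.mem_singleton, not_or] at hi
    rw [hf i hi.1 hi.2, hg i hi.1 hi.2, TensorProduct.tmul_zero, TensorProduct.tmul_zero, add_zero]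

/-- The condition `h` compares weights of `p_a p_b` with `a + b = n - 1` and `d = a - b`, so its
brackets are `Nκ + a + 1` and `Nκ + b + 1`. The auxiliary `u` carries the cross terms of the even
part. -/
theorem isMonogenic_planarSum (hN : 2 ≤ N) (κ : ℝ) (n : ℕ) {w u v : ℤ → ℝ}
    (hw : ∀ d, w (-d) = w d) (hu : ∀ d, u (-d) = -u d) (hv : ∀ d, v (-d) = -v d)
    (hwu : ∀ d, u (d + 1) - u (d - 1) = 2 * w d)
    (h : ∀ d : ℤ, ((N : ℝ) * κ + (n + 1 + d) / 2) * w (d + 1) + κ * u d +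
      ((N : ℝ) * κ + (n + 1 - d) / 2) * v (d - 1) = 0) :
    IsMonogenic κ ((1 : Cl N) ⊗ₜ[ℝ] planarSum hN κ w n +
      (e (ix₁ hN) * e (ix₂ hN)) ⊗ₜ[ℝ] planarSum hN κ v n) := by
  cases n with
  | zero => apply isMonogenic_of_dunkl <;> simp [dunkl_planarSum_zero]
  | succ n =>
    apply isMonogenic_of_dunkl
    · rw [dunkl_ix₁_planarSum, dunkl_ix₂_planarSum, crossSum_odd hN κ hv,
        crossSum_eq_planarSum hN κ hu hwu, smul_zero, sub_zero, planarSum, Finset.smul_sum,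
        ← Finset.sum_add_distrib, ← Finset.sum_add_distrib]
      refine Finset.sum_eq_zero fun p hp => ?_
      have hn : (n : ℝ) = p.1 + p.2 := by exact_mod_cast (mem_antidiagonal.mp hp).symm
      have h' := h ((p.1 : ℤ) - p.2)
      rw [smul_smul, ← add_smul, ← add_smul]
      convert zero_smul ℝ _
      rw [← h']
      push_cast
      rw [hn]
      ring
    · rw [dunkl_ix₁_planarSum, dunkl_ix₂_planarSum, crossSum_odd hN κ hv,
        crossSum_eq_planarSum hN κ hu hwu, smul_zero, add_zero, planarSum, Finset.smul_sum,
        ← Finset.sum_sub_distrib, ← Finset.sum_sub_distrib]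
      refine Finset.sum_eq_zero fun p hp => ?_
      have hn : (n : ℝ) = p.1 + p.2 := by exact_mod_cast (mem_antidiagonal.mp hp).symm
      -- The second Cauchy–Riemann equation is the first at `-d`, by the parities of `w`, `u` and
      -- `v`.
      have h' := h (-((p.1 : ℤ) - p.2))
      rw [show -((p.1 : ℤ) - p.2) + 1 = -((p.1 : ℤ) - p.2 - 1) by ring,
        show -((p.1 : ℤ) - p.2) - 1 = -((p.1 : ℤ) - p.2 + 1) by ring, hw, hu, hv] at h'
      rw [smul_smul, ← sub_smul, ← sub_smul]
      convert zero_smul ℝ _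
      rw [← h']
      push_cast
      rw [hn]
      ring
    · exact fun i => dunkl_planarSum_of_ne hN κ w (n + 1)
    · exact fun i => dunkl_planarSum_of_ne hN κ v (n + 1)

end Criterion

/-! ### Moment functionals -/

section Moment

open Polynomial Polynomial.Chebyshev

/-- The linear functional on `ℝ[s]` with `s ^ k ↦ a k`. -/
def moment (a : ℕ → ℝ) : ℝ[X] →ₗ[ℝ] ℝ := Polynomial.lsum fun k => a k • LinearMap.id

theorem moment_monomial (a : ℕ → ℝ) (k : ℕ) (c : ℝ) : moment a (monomial k c) = a k * c := by
  simp [moment, Polynomial.lsum_apply]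

theorem moment_eq_sum (a : ℕ → ℝ) (f : ℝ[X]) (M : ℕ) (hf : ∀ k, M ≤ k → f.coeff k = 0) :
    moment a f = ∑ k ∈ Finset.range M, a k * f.coeff k := by
  rw [moment, Polynomial.lsum_apply, Polynomial.sum_def]
  refine Finset.sum_subset (fun k hk => ?_) (fun k _ hk => ?_)
  · rw [Finset.mem_range]
    by_contra! h
    exact Polynomial.mem_support_iff.mp hk (hf k h)
  · simp [Polynomial.notMem_support_iff.mp hk]

/-- Linear extension of the recurrence from monomials; it will be applied to `f = T_d`. At `k = 0`
the truncated index `k - 1` is harmless because its factor `k / 2` vanishes. -/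
theorem moment_plus_relation {ε : ℝ} {a b : ℕ → ℝ}
    (h : ∀ k : ℕ, (ε + k / 2) * a (k + 1) - k / 2 * a (k - 1) = (ε + k / 2) * b k) (f : ℝ[X]) :
    moment a (ε • (X * f) - (1 / 2 : ℝ) • ((1 - X ^ 2) * derivative f)) =
      moment b (ε • f + (1 / 2 : ℝ) • (X * derivative f)) := by
  induction f using Polynomial.induction_on' with
  | add p q hp hq =>
    simp only [mul_add, map_add, map_sub, map_smul, smul_eq_mul] at hp hq ⊢
    linarith
  | monomial k c =>
    rw [derivative_monomial, sub_mul, one_mul]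
    simp only [X_mul_monomial, X_pow_mul_monomial, map_add, map_sub, map_smul, smul_eq_mul,
      moment_monomial]
    have hk := h k
    cases k with
    | zero =>
      simp only [Nat.cast_zero, mul_zero] at hk ⊢
      linear_combination c * hk
    | succ k =>
      simp only [add_tsub_cancel_right] at hk ⊢
      linear_combination c * hk

/-- Companion relation, for `g = U_{d-1}`; the factor `k / 2` again kills the truncated index at `k
= 0`. -/
theorem moment_minus_relation {ε κ : ℝ} {a b : ℕ → ℝ}
    (h : ∀ k : ℕ, (ε + (k + 1) / 2) * a (k + 2) + (κ - ε - k / 2) * a k +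
      (ε + (k + 1) / 2) * b (k + 1) - k / 2 * b (k - 1) = 0) (g : ℝ[X]) :
    moment a ((1 / 2 : ℝ) • (X * (X * g - (1 - X ^ 2) * derivative g)) - ε • ((1 - X ^ 2) * g)) +
      κ * moment a g +
      moment b (ε • (X * g) + (1 / 2 : ℝ) • (X * g - (1 - X ^ 2) * derivative g)) = 0 := by
  induction g using Polynomial.induction_on' with
  | add p q hp hq =>
    simp only [mul_add, mul_sub, map_add, map_sub, map_smul, smul_eq_mul]
      at hp hq ⊢
    linarith
  | monomial k c =>
    rw [derivative_monomial, sub_mul, sub_mul, one_mul, one_mul]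
    simp only [mul_sub, X_mul_monomial, X_pow_mul_monomial, map_add, map_sub, map_smul,
      smul_eq_mul, moment_monomial]
    have hk := h k
    cases k with
    | zero =>
      simp only [Nat.cast_zero, mul_zero] at hk ⊢
      linear_combination c * hk
    | succ k =>
      simp only [add_tsub_cancel_right] at hk ⊢
      push_cast at hk ⊢
      linear_combination c * hk

/-- Multiplication by `d` becomes differentiation: `T_d' = d U_{d-1}` and `s U_{d-1} - (1 - s²)
U_{d-1}' = d T_d`. With `T_{d+1}` and `U_{d-2}` expressed through `T_d` and `U_{d-1}`, the claim is
the sum of the two functional relations. -/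
theorem moment_chebyshev_relation {ε κ : ℝ} {a b : ℕ → ℝ}
    (h₁ : ∀ k : ℕ, (ε + k / 2) * a (k + 1) - k / 2 * a (k - 1) = (ε + k / 2) * b k)
    (h₂ : ∀ k : ℕ, (ε + (k + 1) / 2) * a (k + 2) + (κ - ε - k / 2) * a k +
      (ε + (k + 1) / 2) * b (k + 1) - k / 2 * b (k - 1) = 0) (d : ℤ) :
    (ε + d / 2) * moment a (T ℝ (d + 1)) + κ * moment a (U ℝ (d - 1)) +
      (ε - d / 2) * moment b (U ℝ (d - 1 - 1)) = 0 := by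
  have hf := moment_plus_relation h₁ (T ℝ d)
  have hg := moment_minus_relation h₂ (U ℝ (d - 1))
  have hdT : derivative (T ℝ d) = C (d : ℝ) * U ℝ (d - 1) := by
    rw [T_derivative_eq_U]
    simp
  have hdU : X * U ℝ (d - 1) - (1 - X ^ 2) * derivative (U ℝ (d - 1)) = C (d : ℝ) * T ℝ d := by
    rw [← add_one_mul_T_eq_poly_in_U]
    simp
  have hT : T ℝ (d + 1) = X * T ℝ d - (1 - X ^ 2) * U ℝ (d - 1) := by
    have := T_eq_X_mul_T_sub_pol_U ℝ (d - 1)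
    rwa [show d - 1 + 2 = d + 1 by ring, sub_add_cancel] at this
  have hU : U ℝ (d - 1 - 1) = X * U ℝ (d - 1) - T ℝ d := by
    have := T_eq_X_mul_U_sub_U ℝ (d - 2)
    rw [sub_add_cancel, show d - 2 + 1 = d - 1 by ring] at this
    rw [show d - 1 - 1 = d - 2 by ring, this]
    ring
  have key₁ : (ε + d / 2) • T ℝ (d + 1) =
      (ε • (X * T ℝ d) - (1 / 2 : ℝ) • ((1 - X ^ 2) * derivative (T ℝ d))) +
      ((1 / 2 : ℝ) • (X * (X * U ℝ (d - 1) - (1 - X ^ 2) * derivative (U ℝ (d - 1)))) -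
        ε • ((1 - X ^ 2) * U ℝ (d - 1))) := by
    rw [hdU, hdT, hT]
    simp only [smul_eq_C_mul, map_add, div_eq_mul_inv, map_mul, one_mul]
    ring
  have key₂ : (ε - d / 2) • U ℝ (d - 1 - 1) =
      (ε • (X * U ℝ (d - 1)) +
        (1 / 2 : ℝ) • (X * U ℝ (d - 1) - (1 - X ^ 2) * derivative (U ℝ (d - 1)))) -
      (ε • T ℝ d + (1 / 2 : ℝ) • (X * derivative (T ℝ d))) := by
    rw [hdU, hdT, hU]
    simp only [smul_eq_C_mul, map_sub, div_eq_mul_inv, map_mul, one_mul]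
    ring
  have k₁ := congrArg (moment a) key₁
  have k₂ := congrArg (moment b) key₂
  rw [map_smul, smul_eq_mul, map_add] at k₁
  rw [map_smul, smul_eq_mul, map_sub] at k₂
  rw [k₁, k₂]
  linear_combination hf + hg

theorem isMonogenic_moment {N : ℕ} (hN : 2 ≤ N) (κ : ℝ) (n : ℕ) {ε : ℝ}
    (hε : ε = N * κ + (n + 1) / 2) {a b : ℕ → ℝ}
    (h₁ : ∀ k : ℕ, (ε + k / 2) * a (k + 1) - k / 2 * a (k - 1) = (ε + k / 2) * b k)
    (h₂ : ∀ k : ℕ, (ε + (k + 1) / 2) * a (k + 2) + (κ - ε - k / 2) * a k +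
      (ε + (k + 1) / 2) * b (k + 1) - k / 2 * b (k - 1) = 0) :
    IsMonogenic κ ((1 : Cl N) ⊗ₜ[ℝ] planarSum hN κ (fun d => moment a (T ℝ d)) n +
      (e (ix₁ hN) * e (ix₂ hN)) ⊗ₜ[ℝ] planarSum hN κ (fun d => moment b (U ℝ (d - 1))) n) := by
  refine isMonogenic_planarSum (u := fun d => moment a (U ℝ (d - 1))) hN κ n ?_ ?_ ?_ ?_ ?_
  · intro d
    rw [T_neg]
  · intro d
    rw [U_neg_sub_one, map_neg]
  · intro d
    rw [U_neg_sub_one, map_neg]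
  · intro d
    have h := congrArg (moment a) (two_mul_T_eq_U_sub_U ℝ (d - 2))
    rw [sub_add_cancel, map_sub, two_mul, map_add, ← two_mul] at h
    rw [h, add_sub_cancel_right, sub_sub, one_add_one_eq_two]
  · intro d
    have h := moment_chebyshev_relation h₁ h₂ d
    rw [hε] at h
    linear_combination h

/-! ### Degree bounds and moment sequences of fixed parity. -/

theorem coeff_T_eq_zero {d : ℤ} {k : ℕ} (h : d.natAbs < k) : (T ℝ d).coeff k = 0 :=
  coeff_eq_zero_of_natDegree_lt (by rwa [natDegree_T])

theorem coeff_U_sub_one_eq_zero {d : ℤ} {k : ℕ} (h : d.natAbs ≤ k) :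
    (U ℝ (d - 1)).coeff k = 0 := by
  -- For `d = 0` the degree bound says nothing at `k = 0`, but `U_{-1} = 0`.
  rcases eq_or_ne d 0 with rfl | hd
  · simp
  · apply coeff_eq_zero_of_natDegree_lt
    rw [natDegree_U, sub_add_cancel]
    omega

/-- The sequence with `2 j ↦ c j` and `2 j + 1 ↦ 0`. -/
def evenSeq (c : ℕ → ℝ) (k : ℕ) : ℝ := if k % 2 = 0 then c (k / 2) else 0

/-- The sequence with `2 j ↦ 0` and `2 j + 1 ↦ c j`. -/
def oddSeq (c : ℕ → ℝ) (k : ℕ) : ℝ := if k % 2 = 1 then c (k / 2) else 0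

theorem evenSeq_two_mul (c : ℕ → ℝ) (j : ℕ) : evenSeq c (2 * j) = c j := by
  simp [evenSeq]

theorem evenSeq_two_mul_add_one (c : ℕ → ℝ) (j : ℕ) : evenSeq c (2 * j + 1) = 0 := by
  simp [evenSeq, Nat.add_mod]

theorem oddSeq_two_mul (c : ℕ → ℝ) (j : ℕ) : oddSeq c (2 * j) = 0 := by
  simp [oddSeq]

theorem oddSeq_two_mul_add_one (c : ℕ → ℝ) (j : ℕ) : oddSeq c (2 * j + 1) = c j := by
  rw [oddSeq, if_pos (by omega), show (2 * j + 1) / 2 = j by omega]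

theorem sum_range_two_mul (f : ℕ → ℝ) (M : ℕ) :
    ∑ k ∈ Finset.range (2 * M), f k = ∑ j ∈ Finset.range M, (f (2 * j) + f (2 * j + 1)) := by
  induction M with
  | zero => simp
  | succ M ih =>
    rw [show 2 * (M + 1) = 2 * M + 1 + 1 by ring, Finset.sum_range_succ, Finset.sum_range_succ,
      Finset.sum_range_succ, ih, add_assoc]

theorem moment_evenSeq (c : ℕ → ℝ) (f : ℝ[X]) (M : ℕ) (hf : ∀ k, 2 * M ≤ k → f.coeff k = 0) :
    moment (evenSeq c) f = ∑ j ∈ Finset.range M, c j * f.coeff (2 * j) := by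
  rw [moment_eq_sum _ _ _ hf, sum_range_two_mul]
  simp [evenSeq_two_mul, evenSeq_two_mul_add_one]

theorem moment_oddSeq (c : ℕ → ℝ) (f : ℝ[X]) (M : ℕ) (hf : ∀ k, 2 * M ≤ k → f.coeff k = 0) :
    moment (oddSeq c) f = ∑ j ∈ Finset.range M, c j * f.coeff (2 * j + 1) := by
  rw [moment_eq_sum _ _ _ hf, sum_range_two_mul]
  simp [oddSeq_two_mul, oddSeq_two_mul_add_one]

open Finset.HasAntidiagonal in
-- Only `|d| ≤ n` occurs when `a + b = n`, so the finite sums defining `h^±` agree with full moments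
-- of infinite sequences.
theorem sum_smul_eq_planarSum {N : ℕ} (hN : 2 ≤ N) (κ : ℝ) (n M : ℕ) (c : ℕ → ℝ) (w : ℤ → ℝ)
    (q : ℕ → ℤ → ℝ) (hw : ∀ d : ℤ, d.natAbs ≤ n → w d = ∑ j ∈ Finset.range M, c j * q j d) :
    ∑ j ∈ Finset.range M, c j •
      ∑ p ∈ antidiagonal n, q j ((p.1 : ℤ) - p.2) • pProd hN κ p.1 p.2 =
    planarSum hN κ w n := by
  simp only [Finset.smul_sum, smul_smul]
  rw [Finset.sum_comm, planarSum]
  refine Finset.sum_congr rfl fun p hp => ?_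
  have hp' := mem_antidiagonal.mp hp
  rw [← Finset.sum_smul, hw _ (by omega)]

end Moment

/-! ### The coefficients -/

section Coefficients

theorem gE_add_two (v : ℝ) (n : ℕ) : gE v (n + 2) =
    (v + 3 * ((n : ℝ) + 1) + 2) * gE v (n + 1) -
      ((n : ℝ) + 1) * (2 * ((n : ℝ) + 1) + 1) * gE v n := rfl

theorem gO_add_two (v : ℝ) (n : ℕ) : gO v (n + 2) =
    (v + 3 * ((n : ℝ) + 1) + 1) * gO v (n + 1) -
      ((n : ℝ) + 1) * (2 * ((n : ℝ) + 1) - 1) * gO v n := rfl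

/-- A contiguity relation, propagated by the two three-term recurrences; it links the shifted
parameter in `h_{2m+1}^+` with that in `h_{2m+1}^-`. -/
theorem gO_succ_eq_gE (v : ℝ) (n : ℕ) :
    gE (v + 1) (n + 1) - 2 * (n + 1) * gE (v + 1) n = gO v (n + 1) := by
  induction n using Nat.twoStepInduction with
  | zero =>
    simp only [gE, gO, Nat.cast_zero]
    ring
  | one =>
    simp only [gE, gO, Nat.cast_zero, Nat.cast_one]
    ring
  | more n h0 h1 =>
    have e3 := gE_add_two (v + 1) (n + 1)
    have e2 := gE_add_two (v + 1) n
    have o3 := gO_add_two v (n + 1)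
    push_cast at *
    linear_combination e3 - o3 + (v + 3 * ((n : ℝ) + 2) + 1) * h1 -
      ((n : ℝ) + 2) * (2 * n + 3) * h0 - 2 * ((n : ℝ) + 2) * e2

/-- The factor `v` here is the numerator `Nκ - κ + m` in the even-degree statement. -/
theorem mul_gE_eq_gO (v : ℝ) (n : ℕ) :
    gO v (n + 1) - (2 * n + 1) * gO v n = v * gE v n := by
  induction n using Nat.twoStepInduction with
  | zero => norm_num [gE, gO]
  | one =>
    simp only [gE, gO, Nat.cast_zero, Nat.cast_one]
    ring
  | more n h0 h1 =>
    have e2 := gE_add_two v n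
    have o3 := gO_add_two v (n + 1)
    have o2 := gO_add_two v n
    push_cast at *
    linear_combination o3 - v * e2 + (v + 3 * (n : ℝ) + 5) * h1 -
      ((n : ℝ) + 1) * (2 * n + 3) * h0 - (2 * (n : ℝ) + 3) * o2

theorem poch_zero (a : ℝ) : poch a 0 = 1 := by
  simp [poch]

theorem poch_succ (a : ℝ) (j : ℕ) : poch a (j + 1) = poch a j * (a + j) :=
  ascPochhammer_succ_eval j a

theorem poch_succ_left (a : ℝ) (j : ℕ) : poch a (j + 1) = a * poch (a + 1) j := by
  simp [poch, ascPochhammer_succ_left, Polynomial.eval_comp]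

theorem poch_ne_zero {a : ℝ} (h : ∀ k : ℕ, a + k ≠ 0) (j : ℕ) : poch a j ≠ 0 := by
  induction j with
  | zero => simp [poch_zero]
  | succ j ih =>
    rw [poch_succ]
    exact mul_ne_zero ih (h j)

end Coefficients

/-! ### The planar monogenic polynomials -/

section Main

open Polynomial.Chebyshev

variable {N : ℕ}

/-- In odd degree `T_d` is paired with an odd sequence and `U_{d-1}` with an even one, so each
moment recurrence is trivial for one parity of `k`. -/
theorem isMonogenic_odd (hN : 2 ≤ N) (κ : ℝ) (m : ℕ) {ε : ℝ} (hε : ε = N * κ + m + 1)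
    {c c' : ℕ → ℝ} (h₀ : c 0 = c' 0)
    (h₁ : ∀ j : ℕ, (ε + j + 1) * c (j + 1) - (j + 1) * c j = (ε + j + 1) * c' (j + 1))
    (h₂ : ∀ j : ℕ, (ε + j + 1) * c (j + 1) + (κ - ε - j - 1 / 2) * c j +
      (ε + j + 1) * c' (j + 1) - (j + 1 / 2) * c' j = 0) :
    IsMonogenic κ
      ((1 : Cl N) ⊗ₜ[ℝ] (∑ j ∈ Finset.range (m + 1), c j • phi hN κ (2 * m + 1) (2 * j + 1)) +
        (e (ix₁ hN) * e (ix₂ hN)) ⊗ₜ[ℝ]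
          (∑ j ∈ Finset.range (m + 1), c' j • psi hN κ (2 * m + 1) (2 * j))) := by
  simp only [phi_eq_sum, psi_eq_sum]
  rw [sum_smul_eq_planarSum hN κ _ _ c (fun d => moment (oddSeq c) (T ℝ d))
      (fun j d => (T ℝ d).coeff (2 * j + 1))
      fun d hd => moment_oddSeq c _ _ fun k hk => coeff_T_eq_zero (by omega),
    sum_smul_eq_planarSum hN κ _ _ c' (fun d => moment (evenSeq c') (U ℝ (d - 1)))
      (fun j d => (U ℝ (d - 1)).coeff (2 * j))
      fun d hd => moment_evenSeq c' _ _ fun k hk => coeff_U_sub_one_eq_zero (by omega)]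
  apply isMonogenic_moment hN κ (2 * m + 1) (ε := ε) (by rw [hε]; push_cast; ring)
  · intro k
    obtain ⟨j, rfl | rfl⟩ := Nat.even_or_odd' k
    · rw [oddSeq_two_mul_add_one, evenSeq_two_mul]
      cases j with
      | zero =>
        rw [h₀]
        simp
      | succ j =>
        rw [show 2 * (j + 1) - 1 = 2 * j + 1 by omega, oddSeq_two_mul_add_one]
        push_cast
        linear_combination h₁ j
    · rw [show 2 * j + 1 + 1 = 2 * (j + 1) by ring, add_tsub_cancel_right, oddSeq_two_mul,
        oddSeq_two_mul, evenSeq_two_mul_add_one]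
      ring
  · intro k
    obtain ⟨j, rfl | rfl⟩ := Nat.even_or_odd' k
    · rw [show 2 * j + 2 = 2 * (j + 1) by ring, oddSeq_two_mul, oddSeq_two_mul,
        evenSeq_two_mul_add_one]
      cases j with
      | zero => simp
      | succ j =>
        rw [show 2 * (j + 1) - 1 = 2 * j + 1 by omega, evenSeq_two_mul_add_one]
        ring
    · rw [show 2 * j + 1 + 2 = 2 * (j + 1) + 1 by ring, show 2 * j + 1 + 1 = 2 * (j + 1) by ring,
        add_tsub_cancel_right, oddSeq_two_mul_add_one, oddSeq_two_mul_add_one, evenSeq_two_mul,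
        evenSeq_two_mul]
      push_cast
      linear_combination h₂ j

theorem isMonogenic_even (hN : 2 ≤ N) (κ : ℝ) (m : ℕ) {δ : ℝ} (hδ : δ = N * κ + m + 1)
    {c c' : ℕ → ℝ}
    (h₁ : ∀ j : ℕ, (δ + j) * c (j + 1) - (j + 1 / 2) * c j = (δ + j) * c' j)
    (h₀ : δ * c 1 + (κ - δ + 1 / 2) * c 0 + δ * c' 0 = 0)
    (h₂ : ∀ j : ℕ, (δ + j + 1) * c (j + 2) + (κ - δ - j - 1 / 2) * c (j + 1) +
      (δ + j + 1) * c' (j + 1) - (j + 1) * c' j = 0) :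
    IsMonogenic κ
      ((1 : Cl N) ⊗ₜ[ℝ] (∑ j ∈ Finset.range (m + 1), c j • phi hN κ (2 * m) (2 * j)) +
        (e (ix₁ hN) * e (ix₂ hN)) ⊗ₜ[ℝ]
          (∑ j ∈ Finset.range m, c' j • psi hN κ (2 * m) (2 * j + 1))) := by
  simp only [phi_eq_sum, psi_eq_sum]
  rw [sum_smul_eq_planarSum hN κ _ _ c (fun d => moment (evenSeq c) (T ℝ d))
      (fun j d => (T ℝ d).coeff (2 * j))
      fun d hd => moment_evenSeq c _ _ fun k hk => coeff_T_eq_zero (by omega),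
    sum_smul_eq_planarSum hN κ _ _ c' (fun d => moment (oddSeq c') (U ℝ (d - 1)))
      (fun j d => (U ℝ (d - 1)).coeff (2 * j + 1))
      fun d hd => moment_oddSeq c' _ _ fun k hk => coeff_U_sub_one_eq_zero (by omega)]
  -- Here `Nκ + (2m + 1) / 2` is a half step below `δ = Nκ + m + 1`, the base of the Pochhammer
  -- symbols of `h_{2m}^+`.
  apply isMonogenic_moment hN κ (2 * m) (ε := δ - 1 / 2) (by rw [hδ]; push_cast; ring)
  · intro k
    obtain ⟨j, rfl | rfl⟩ := Nat.even_or_odd' k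
    · rw [evenSeq_two_mul_add_one, oddSeq_two_mul]
      cases j with
      | zero => simp
      | succ j =>
        rw [show 2 * (j + 1) - 1 = 2 * j + 1 by omega, evenSeq_two_mul_add_one]
        ring
    · rw [show 2 * j + 1 + 1 = 2 * (j + 1) by ring, add_tsub_cancel_right, evenSeq_two_mul,
        evenSeq_two_mul, oddSeq_two_mul_add_one]
      push_cast
      linear_combination h₁ j
  · intro k
    obtain ⟨j, rfl | rfl⟩ := Nat.even_or_odd' k
    · rw [show 2 * j + 2 = 2 * (j + 1) by ring, evenSeq_two_mul, evenSeq_two_mul,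
        oddSeq_two_mul_add_one]
      cases j with
      | zero =>
        norm_num
        linear_combination h₀
      | succ j =>
        rw [show 2 * (j + 1) - 1 = 2 * j + 1 by omega, oddSeq_two_mul_add_one]
        push_cast
        linear_combination h₂ j
    · rw [show 2 * j + 1 + 2 = 2 * (j + 1) + 1 by ring, show 2 * j + 1 + 1 = 2 * (j + 1) by ring,
        add_tsub_cancel_right, evenSeq_two_mul_add_one, evenSeq_two_mul_add_one, oddSeq_two_mul,
        oddSeq_two_mul]
      ring

theorem isMonogenic_hPlusOdd_add_hMinusOdd (hN : 2 ≤ N) (κ : ℝ)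
    (hκ : ∀ k : ℕ, 1 ≤ k → (N : ℝ) * κ + k ≠ 0) (m : ℕ) :
    IsMonogenic κ ((1 : Cl N) ⊗ₜ[ℝ] hPlusOdd hN κ m +
      (e (ix₁ hN) * e (ix₂ hN)) ⊗ₜ[ℝ] hMinusOdd hN κ m) := by
  have hne (k : ℕ) : (N * κ + m + 2 : ℝ) + k ≠ 0 := by
    have := hκ (m + 2 + k) (by omega)
    push_cast at this
    rwa [← add_assoc, ← add_assoc] at this
  -- The recurrences are needed for every `j`, beyond the range of the sums, so no Pochhammer symbol
  -- may vanish.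
  have hp (j : ℕ) := poch_ne_zero hne j
  apply isMonogenic_odd hN κ m (ε := N * κ + m + 1) rfl
  · simp [gE, gO, poch_zero]
  · intro j
    have hj := hne j
    have hpj := hp j
    rw [← gO_succ_eq_gE, poch_succ, pow_succ]
    field_simp
    ring
  · intro j
    have hj := hne j
    have hpj := hp j
    rw [← gO_succ_eq_gE, poch_succ, pow_succ]
    -- The contiguity relation rewrites `gO` only at successor indices, so `gO` at `0` is treated by
    -- hand.
    cases j with
    | zero =>
      simp only [gE, gO, poch_zero] at hj ⊢
      norm_num at hj ⊢
      field_simp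
      ring
    | succ j =>
      rw [← gO_succ_eq_gE, gE_add_two]
      push_cast at hj ⊢
      field_simp
      ring

theorem isMonogenic_hPlusEven_add_hMinusEven (hN : 2 ≤ N) (κ : ℝ)
    (hκ : ∀ k : ℕ, 1 ≤ k → (N : ℝ) * κ + k ≠ 0) (m : ℕ) :
    IsMonogenic κ ((1 : Cl N) ⊗ₜ[ℝ] hPlusEven hN κ m +
      (e (ix₁ hN) * e (ix₂ hN)) ⊗ₜ[ℝ]
        (((N * κ - κ + m) / (2 * (N * κ + m + 1))) • hMinusEven hN κ m)) := by
  have hne (k : ℕ) : (N * κ + m + 1 : ℝ) + k ≠ 0 := by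
    have := hκ (m + 1 + k) (by omega)
    push_cast at this
    rwa [← add_assoc, ← add_assoc] at this
  have hp (j : ℕ) := poch_ne_zero hne j
  have hδ : (N * κ + m + 1 : ℝ) ≠ 0 := by simpa using hne 0
  -- The extra scalar is absorbed: its numerator by `mul_gE_eq_gO`, its denominator by shifting the
  -- Pochhammer base, its `1/2` by the power of two. All coefficients are then in terms of `gO` and
  -- one Pochhammer family.
  have hc' (j : ℕ) : (N * κ - κ + m) / (2 * (N * κ + m + 1)) *
      ((2 : ℝ)⁻¹ ^ j * (gE (N * κ - κ + m) j / poch (N * κ + m + 2) j)) =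
      (2 : ℝ)⁻¹ ^ (j + 1) *
        ((gO (N * κ - κ + m) (j + 1) - (2 * j + 1) * gO (N * κ - κ + m) j) /
          poch (N * κ + m + 1) (j + 1)) := by
    rw [mul_gE_eq_gO, poch_succ_left, show (N * κ + m + 1 + 1 : ℝ) = N * κ + m + 2 by ring,
      pow_succ, div_mul_eq_div_div, div_mul_eq_div_div]
    ring
  rw [hMinusEven, Finset.smul_sum]
  simp only [smul_smul, hc']
  apply isMonogenic_even hN κ m (δ := N * κ + m + 1) rfl
  · intro j
    have hj := hne j
    have hpj := hp j
    rw [poch_succ, pow_succ]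
    field_simp
  · simp only [gO, poch_succ, poch_zero]
    norm_num
    field_simp
    ring
  · intro j
    have hj := hne j
    have hj' := hne (j + 1)
    have hpj := hp j
    rw [gO_add_two, poch_succ _ (j + 1), poch_succ, pow_succ _ (j + 1), pow_succ]
    push_cast at hj' ⊢
    field_simp
    ring

end Main

end PlanarMonogenic

end

open PlanarMonogenic in
theorem mainTheorem4 (N : ℕ) (hN : 2 ≤ N) (κ : ℝ) (hκ : ∀ k : ℕ, 1 ≤ k → (N : ℝ) * κ + k ≠ 0)
    (m : ℕ) :
    IsMonogenic κ
      ((1 : Cl N) ⊗ₜ[ℝ] hPlusOdd hN κ m + (e (ix₁ hN) * e (ix₂ hN)) ⊗ₜ[ℝ] hMinusOdd hN κ m) ∧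
    IsMonogenic κ
      ((1 : Cl N) ⊗ₜ[ℝ] hPlusEven hN κ m +
        (e (ix₁ hN) * e (ix₂ hN)) ⊗ₜ[ℝ]
          (((N * κ - κ + m) / (2 * (N * κ + m + 1))) • hMinusEven hN κ m)) :=
  ⟨isMonogenic_hPlusOdd_add_hMinusOdd hN κ hκ m, isMonogenic_hPlusEven_add_hMinusEven hN κ hκ m⟩
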